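/- Let $\mathcal L_{\mathbb N}$ be the first-order language with equality and signature $\{0,\mathrm S,+,\times\}$, and let $\mathcal L_T=\mathcal L_{\mathbb N}\cup\{T\}$ with $T$ a unary predicate. Formulas are built from the atoms $s=t$ and $Tt$ and the constants $\top,\bot$ by $\neg,\wedge,\forall$; free and bound variables are kept distinct, and formulas that differ only in the names of bound variables are identified. The logical complexity is $|\varphi|=0$ for atoms and $\top,\bot$, $|\neg\varphi|=|\forall x\varphi|=|\varphi|+1$, and $|\varphi\wedge\psi|=\max(|\varphi|,|\psi|)+1$. Fix a standard (injective) Gödel numbering $\#$ of $\mathcal L_T$, and let $\bar l$ be the numeral of $l$. Sequents $\Gamma\Rightarrow\Delta$ consist of finite multisets of formulas. The system $\mathrm{LPT}_{\mathbb N}$ has the following initial sequents and rules, in which $r,s,t$ are arbitrary terms (there are no rules for $\top$ and $\bot$): * initial sequents $\Gamma,s=t\Rightarrow s=t,\Delta$ and $\Gamma,\mathrm S s=0\Rightarrow\Delta$; * cut: from $\Gamma\Rightarrow\Delta,\varphi$ and $\varphi,\Gamma\Rightarrow\Delta$ infer $\Gamma\Rightarrow\Delta$; * negation: from $\Gamma\Rightarrow\varphi,\Delta$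 infer $\Gamma,\neg\varphi\Rightarrow\Delta$; from $\Gamma,\varphi\Rightarrow\Delta$ infer $\Gamma\Rightarrow\neg\varphi,\Delta$; * conjunction: from $\Gamma,\varphi,\psi\Rightarrow\Delta$ infer $\Gamma,\varphi\wedge\psi\Rightarrow\Delta$; from $\Gamma\Rightarrow\varphi,\Delta$ and $\Gamma\Rightarrow\psi,\Delta$ infer $\Gamma\Rightarrow\varphi\wedge\psi,\Delta$; * quantifier: from $\Gamma,\forall x\varphi,\varphi(s/x)\Rightarrow\Delta$ infer $\Gamma,\forall x\varphi\Rightarrow\Delta$; from $\Gamma\Rightarrow\varphi(y/x),\Delta$ infer $\Gamma\Rightarrow\forall x\varphi,\Delta$ if the variable $y$ is not free in $\Gamma,\Delta,\forall x\varphi$; * equality: from $\Gamma,t=t\Rightarrow\Delta$ infer $\Gamma\Rightarrow\Delta$; from $s=t,\varphi(s),\varphi(t),\Gamma\Rightarrow\Delta$ infer $s=t,\varphi(t),\Gamma\Rightarrow\Delta$, for $\varphi(v)$ an atomic formula of $\mathcal L_{\mathbb N}$; * arithmetic: from $\Gamma,s=t,\mathrm Ss=\mathrm St\Rightarrow\Delta$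 infer $\Gamma,\mathrm Ss=\mathrm St\Rightarrow\Delta$; from $\Gamma,s=0\Rightarrow\Delta$ and $\Gamma,s=\mathrm S y\Rightarrow\Delta$ infer $\Gamma\Rightarrow\Delta$ if the variable $y$ is not free in $\Gamma,\Delta,s$; from $\Gamma,e\Rightarrow\Delta$ infer $\Gamma\Rightarrow\Delta$, where $e$ is one of $s+0=s$, $s+\mathrm St=\mathrm S(s+t)$, $s\times0=0$, $s\times\mathrm St=(s\times t)+s$; * truth: from $\Gamma\Rightarrow\varphi,\Delta$ infer $\Gamma\Rightarrow T\bar l,\Delta$, and from $\Gamma,\varphi\Rightarrow\Delta$ infer $\Gamma,T\bar l\Rightarrow\Delta$, where $\varphi$ is a sentence of $\mathcal L_T$ and $l=\#\varphi$. The length of a derivation is the height of its tree (initial sequents have length $0$). The rank of a cut on $\varphi$ is $|\varphi|+1$, and the cut rank of a derivation is the maximum of the ranks of its cuts ($0$ if there are none). The $T$-complexity $\tau$ of formula occurrences in a derivation is defined thus: it is $0$ for all occurrences in initial sequents and for all formulas of $\mathcal L_{\mathbb N}$; the principal formula of a truth rule gets $\tau(T\bar l)=\tau(\varphi)+1$;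 the principal formula of a logical rule gets the maximum of the values of its active formulas in the premisses; side formulas keep their value, where in rules with two premisses the maximum of the two corresponding values is taken. The $T$-complexity of a derivation is the maximum over all occurrences in it. Write $\vdash^{n}_{m,k}\Gamma\Rightarrow\Delta$ if $\Gamma\Rightarrow\Delta$ has a derivation in $\mathrm{LPT}_{\mathbb N}$ of length $\le n$, cut rank $\le m$ and $T$-complexity $\le k$. Let $2^n_0=n$ and $2^n_{m+1}=2^{2^n_m}$. **Claim.** Cut is eliminable in $\mathrm{LPT}_{\mathbb N}$, with a hyperexponential bound on the length and without increase of $T$-complexity: there is a constant $C$ such that for all $n,m,k,\Gamma,\Delta$, if $\vdash^{n}_{m,k}\Gamma\Rightarrow\Delta$, then $$\vdash^{\,C\cdot 2^{n}_{n}}_{0,k}\Gamma\Rightarrow\Delta,$$ and if moreover $k=0$ (no truth rule is used), then also $\vdash^{\,C\cdot 2^{n}_{m}}_{0,0}\Gamma\Rightarrow\Delta$. -/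

import Mathlib

namespace LPTN

/-- Terms of the language of arithmetic `{0, S, +, ×}` in the scope of `n` quantifiers. Free variables
(`fv`) and bound variables (`bv`) are kept apart; the bound variable `bv i` refers to the `i`-th of
the `n` enclosing quantifiers, counted from the outside. `Tm 0` is the type of ordinary terms. -/
inductive Tm (n : ℕ) : Type
  | fv : ℕ → Tm n
  | bv : Fin n → Tm n
  | zero : Tm n
  | succ : Tm n → Tm n
  | add : Tm n → Tm n → Tm n
  | mul : Tm n → Tm n → Tm n

namespace Tm

/-- An ordinary term, read in the scope of `n` quantifiers. -/
def lift {n : ℕ} : Tm 0 → Tm n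
  | fv x => fv x
  | bv i => i.elim0
  | zero => zero
  | succ t => succ (lift t)
  | add s t => add (lift s) (lift t)
  | mul s t => mul (lift s) (lift t)

/-- `inst s t` is the result of replacing the variable of the outermost quantifier in `t` by `s`. -/
def inst {n : ℕ} (s : Tm 0) : Tm (n + 1) → Tm n
  | fv x => fv x
  | bv i => Fin.cases (motive := fun _ => Tm n) (lift s) (fun j => bv j) i
  | zero => zero
  | succ t => succ (inst s t)
  | add t u => add (inst s t) (inst s u)
  | mul t u => mul (inst s t) (inst s u)

/-- The free variables of a term. -/
def FV {n : ℕ} : Tm n → Finset ℕ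
  | fv x => {x}
  | bv _ => ∅
  | zero => ∅
  | succ t => FV t
  | add s t => FV s ∪ FV t
  | mul s t => FV s ∪ FV t

/-- The numeral of a natural number. -/
def numeral {n : ℕ} : ℕ → Tm n
  | 0 => zero
  | l + 1 => succ (numeral l)

/-- The Gödel number of a term. -/
def code {n : ℕ} : Tm n → ℕ
  | fv x => Nat.pair 0 x
  | bv i => Nat.pair 1 i
  | zero => Nat.pair 2 0
  | succ t => Nat.pair 3 (code t)
  | add s t => Nat.pair 4 (Nat.pair (code s) (code t))
  | mul s t => Nat.pair 5 (Nat.pair (code s) (code t))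

theorem code_injective {n : ℕ} : Function.Injective (code (n := n)) := by
  intro s
  induction s with
  | fv x => intro t h; cases t <;> simp_all [code, Nat.pair_eq_pair]
  | bv x => intro t h; cases t <;> simp_all [code, Nat.pair_eq_pair, Fin.ext_iff]
  | zero => intro t h; cases t <;> simp_all [code, Nat.pair_eq_pair]
  | succ s ih =>
    intro t h
    cases t <;> simp [code, Nat.pair_eq_pair] at h
    rw [ih h]
  | add s s' ih ih' =>
    intro t h
    cases t <;> simp [code, Nat.pair_eq_pair] at h
    rw [ih h.1, ih' h.2]
  | mul s s' ih ih' =>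
    intro t h
    cases t <;> simp [code, Nat.pair_eq_pair] at h
    rw [ih h.1, ih' h.2]

end Tm

/-- Formulas of the language of arithmetic with the truth predicate, in the scope of `n` quantifiers.
`Fml 0` is the type of ordinary formulas. -/
inductive Fml : ℕ → Type
  | bot {n : ℕ} : Fml n
  | top {n : ℕ} : Fml n
  | eq {n : ℕ} : Tm n → Tm n → Fml n
  | tr {n : ℕ} : Tm n → Fml n
  | neg {n : ℕ} : Fml n → Fml n
  | and {n : ℕ} : Fml n → Fml n → Fml n
  | all {n : ℕ} : Fml (n + 1) → Fml n

namespace Fml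

/-- `inst s φ` is the result of replacing the variable of the outermost quantifier in `φ` by `s`:
if `all φ` is the formula `∀x φ`, then `inst s φ` is `φ(s/x)`. -/
def inst (s : Tm 0) : {n : ℕ} → Fml (n + 1) → Fml n
  | _, bot => bot
  | _, top => top
  | _, eq t u => eq (Tm.inst s t) (Tm.inst s u)
  | _, tr t => tr (Tm.inst s t)
  | _, neg φ => neg (inst s φ)
  | _, and φ ψ => and (inst s φ) (inst s ψ)
  | _, all φ => all (inst s φ)

/-- The free variables of a formula. -/
def FV : {n : ℕ} → Fml n → Finset ℕ
  | _, bot => ∅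
  | _, top => ∅
  | _, eq s t => s.FV ∪ t.FV
  | _, tr t => t.FV
  | _, neg φ => FV φ
  | _, and φ ψ => FV φ ∪ FV ψ
  | _, all φ => FV φ

/-- A sentence is a formula without free variables. -/
def IsSentence (φ : Fml 0) : Prop := φ.FV = ∅

/-- The logical complexity of a formula. -/
def complexity : {n : ℕ} → Fml n → ℕ
  | _, bot => 0
  | _, top => 0
  | _, eq _ _ => 0
  | _, tr _ => 0
  | _, neg φ => complexity φ + 1
  | _, and φ ψ => max (complexity φ) (complexity ψ) + 1
  | _, all φ => complexity φ + 1

/-- The Gödel number of a formula. -/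
def code : {n : ℕ} → Fml n → ℕ
  | _, bot => Nat.pair 6 0
  | _, top => Nat.pair 7 0
  | _, eq s t => Nat.pair 8 (Nat.pair s.code t.code)
  | _, tr t => Nat.pair 9 t.code
  | _, neg φ => Nat.pair 10 (code φ)
  | _, and φ ψ => Nat.pair 11 (Nat.pair (code φ) (code ψ))
  | _, all φ => Nat.pair 12 (code φ)

theorem code_injective {n : ℕ} : Function.Injective (code (n := n)) := by
  intro φ
  induction φ with
  | bot => intro ψ h; cases ψ <;> simp_all [code, Nat.pair_eq_pair]
  | top => intro ψ h; cases ψ <;> simp_all [code, Nat.pair_eq_pair]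
  | eq s t =>
    intro ψ h
    cases ψ <;> simp [code, Nat.pair_eq_pair] at h
    rw [Tm.code_injective h.1, Tm.code_injective h.2]
  | tr t =>
    intro ψ h
    cases ψ <;> simp [code, Nat.pair_eq_pair] at h
    rw [Tm.code_injective h]
  | neg φ ih =>
    intro ψ h
    cases ψ <;> simp [code, Nat.pair_eq_pair] at h
    rw [ih h]
  | and φ φ' ih ih' =>
    intro ψ h
    cases ψ <;> simp [code, Nat.pair_eq_pair] at h
    rw [ih h.1, ih' h.2]
  | all φ ih =>
    intro ψ h
    cases ψ <;> simp [code, Nat.pair_eq_pair] at h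
    rw [ih h]

end Fml

/-- The truth ascription `T l̄`, where `l` is the Gödel number of `φ`. -/
def truthOf (φ : Fml 0) : Fml 0 := Fml.tr (Tm.numeral φ.code)

/-- A finite multiset of formula occurrences, each with its truth complexity in the derivation. -/
abbrev Ctx : Type := Multiset (Fml 0 × ℕ)

/-- A context shared by the two premisses of a rule: each occurrence in the conclusion comes with its
truth complexity in the left and in the right premiss. -/
abbrev Ctx2 : Type := Multiset (Fml 0 × ℕ × ℕ)

/-- The context in the left premiss. -/
def Ctx2.left (Γ : Ctx2) : Ctx := Γ.map fun a => (a.1, a.2.1)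

/-- The context in the right premiss. -/
def Ctx2.right (Γ : Ctx2) : Ctx := Γ.map fun a => (a.1, a.2.2)

/-- The context in the conclusion: the truth complexity of an occurrence is the maximum of the truth
complexities of the corresponding occurrences in the premisses. -/
def Ctx2.join (Γ : Ctx2) : Ctx := Γ.map fun a => (a.1, max a.2.1 a.2.2)

/-- The underlying multiset of formulas. -/
def Ctx.forget (Γ : Ctx) : Multiset (Fml 0) := Γ.map Prod.fst

/-- The variable `y` is not free in any formula of the context. -/
def Ctx.Fresh (y : ℕ) (Γ : Ctx) : Prop := ∀ a ∈ Γ, y ∉ a.1.FV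

open Tm Fml in
/-- `Der m k n Γ Δ`: the sequent `Γ ⇒ Δ`, with the truth complexities attached to its formula
occurrences, has a derivation of length at most `n` and cut rank at most `m` in which all truth
complexities are at most `k`. The metavariables `s`, `t` in the arithmetical rules stand for
arbitrary terms. Truth complexities increase at the truth rules only, so that the bound `k` has to be
imposed only there. -/
inductive Der (m k : ℕ) : ℕ → Ctx → Ctx → Prop
  /-- initial sequents, for atomic formulas of the language of arithmetic -/
  | ref (n : ℕ) (Γ Δ : Multiset (Fml 0)) (s t : Tm 0) :
      Der m k n ((eq s t, 0) ::ₘ Γ.map fun φ => (φ, 0)) ((eq s t, 0) ::ₘ Δ.map fun φ => (φ, 0))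
  | cut {n n₀ n₁ : ℕ} (Γ Δ : Ctx2) (φ : Fml 0) (i j : ℕ) (h₀ : n₀ < n) (h₁ : n₁ < n)
      (hm : φ.complexity + 1 ≤ m)
      (d₀ : Der m k n₀ Γ.left ((φ, i) ::ₘ Δ.left))
      (d₁ : Der m k n₁ ((φ, j) ::ₘ Γ.right) Δ.right) :
      Der m k n Γ.join Δ.join
  | negL {n n₀ : ℕ} (Γ Δ : Ctx) (φ : Fml 0) (i : ℕ) (h₀ : n₀ < n)
      (d : Der m k n₀ Γ ((φ, i) ::ₘ Δ)) :
      Der m k n ((neg φ, i) ::ₘ Γ) Δ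
  | negR {n n₀ : ℕ} (Γ Δ : Ctx) (φ : Fml 0) (i : ℕ) (h₀ : n₀ < n)
      (d : Der m k n₀ ((φ, i) ::ₘ Γ) Δ) :
      Der m k n Γ ((neg φ, i) ::ₘ Δ)
  | andL {n n₀ : ℕ} (Γ Δ : Ctx) (φ ψ : Fml 0) (i j : ℕ) (h₀ : n₀ < n)
      (d : Der m k n₀ ((φ, i) ::ₘ (ψ, j) ::ₘ Γ) Δ) :
      Der m k n ((and φ ψ, max i j) ::ₘ Γ) Δ
  | andR {n n₀ n₁ : ℕ} (Γ Δ : Ctx2) (φ ψ : Fml 0) (i j : ℕ) (h₀ : n₀ < n) (h₁ : n₁ < n)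
      (d₀ : Der m k n₀ Γ.left ((φ, i) ::ₘ Δ.left))
      (d₁ : Der m k n₁ Γ.right ((ψ, j) ::ₘ Δ.right)) :
      Der m k n Γ.join ((and φ ψ, max i j) ::ₘ Δ.join)
  | allL {n n₀ : ℕ} (Γ Δ : Ctx) (φ : Fml 1) (s : Tm 0) (i j : ℕ) (h₀ : n₀ < n)
      (d : Der m k n₀ ((all φ, i) ::ₘ (φ.inst s, j) ::ₘ Γ) Δ) :
      Der m k n ((all φ, max i j) ::ₘ Γ) Δ
  | allR {n n₀ : ℕ} (Γ Δ : Ctx) (φ : Fml 1) (y : ℕ) (i : ℕ) (h₀ : n₀ < n)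
      (hΓ : Γ.Fresh y) (hΔ : Δ.Fresh y) (hφ : y ∉ (all φ).FV)
      (d : Der m k n₀ Γ ((φ.inst (fv y), i) ::ₘ Δ)) :
      Der m k n Γ ((all φ, i) ::ₘ Δ)
  | eq1 {n n₀ : ℕ} (Γ Δ : Ctx) (t : Tm 0) (h₀ : n₀ < n)
      (d : Der m k n₀ ((eq t t, 0) ::ₘ Γ) Δ) :
      Der m k n Γ Δ
  /-- replacement in the equation `φ(v)`, which is `a = b` with `v` the variable `bv 0` -/
  | eq2 {n n₀ : ℕ} (Γ Δ : Ctx) (s t : Tm 0) (a b : Tm 1) (h₀ : n₀ < n)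
      (d : Der m k n₀
        ((eq s t, 0) ::ₘ (eq (Tm.inst s a) (Tm.inst s b), 0) ::ₘ
          (eq (Tm.inst t a) (Tm.inst t b), 0) ::ₘ Γ) Δ) :
      Der m k n ((eq s t, 0) ::ₘ (eq (Tm.inst t a) (Tm.inst t b), 0) ::ₘ Γ) Δ
  | q1 (n : ℕ) (Γ Δ : Multiset (Fml 0)) (s : Tm 0) :
      Der m k n ((eq (succ s) zero, 0) ::ₘ Γ.map fun φ => (φ, 0)) (Δ.map fun φ => (φ, 0))
  | q2 {n n₀ : ℕ} (Γ Δ : Ctx) (s t : Tm 0) (h₀ : n₀ < n)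
      (d : Der m k n₀ ((eq s t, 0) ::ₘ (eq (succ s) (succ t), 0) ::ₘ Γ) Δ) :
      Der m k n ((eq (succ s) (succ t), 0) ::ₘ Γ) Δ
  | q3 {n n₀ n₁ : ℕ} (Γ Δ : Ctx2) (s : Tm 0) (y : ℕ) (h₀ : n₀ < n) (h₁ : n₁ < n)
      (hΓ : Γ.join.Fresh y) (hΔ : Δ.join.Fresh y) (hs : y ∉ s.FV)
      (d₀ : Der m k n₀ ((eq s zero, 0) ::ₘ Γ.left) Δ.left)
      (d₁ : Der m k n₁ ((eq s (succ (fv y)), 0) ::ₘ Γ.right) Δ.right) :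
      Der m k n Γ.join Δ.join
  | q4 {n n₀ : ℕ} (Γ Δ : Ctx) (s : Tm 0) (h₀ : n₀ < n)
      (d : Der m k n₀ ((eq (add s zero) s, 0) ::ₘ Γ) Δ) :
      Der m k n Γ Δ
  | q5 {n n₀ : ℕ} (Γ Δ : Ctx) (s t : Tm 0) (h₀ : n₀ < n)
      (d : Der m k n₀ ((eq (add s (succ t)) (succ (add s t)), 0) ::ₘ Γ) Δ) :
      Der m k n Γ Δ
  | q6 {n n₀ : ℕ} (Γ Δ : Ctx) (s : Tm 0) (h₀ : n₀ < n)
      (d : Der m k n₀ ((eq (mul s zero) zero, 0) ::ₘ Γ) Δ) :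
      Der m k n Γ Δ
  | q7 {n n₀ : ℕ} (Γ Δ : Ctx) (s t : Tm 0) (h₀ : n₀ < n)
      (d : Der m k n₀ ((eq (mul s (succ t)) (add (mul s t) s), 0) ::ₘ Γ) Δ) :
      Der m k n Γ Δ
  | trR {n n₀ : ℕ} (Γ Δ : Ctx) (φ : Fml 0) (i : ℕ) (h₀ : n₀ < n) (hφ : φ.IsSentence)
      (hk : i + 1 ≤ k)
      (d : Der m k n₀ Γ ((φ, i) ::ₘ Δ)) :
      Der m k n Γ ((truthOf φ, i + 1) ::ₘ Δ)
  | trL {n n₀ : ℕ} (Γ Δ : Ctx) (φ : Fml 0) (i : ℕ) (h₀ : n₀ < n) (hφ : φ.IsSentence)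
      (hk : i + 1 ≤ k)
      (d : Der m k n₀ ((φ, i) ::ₘ Γ) Δ) :
      Der m k n ((truthOf φ, i + 1) ::ₘ Γ) Δ

/-- `Provable n m k Γ Δ`: the sequent `Γ ⇒ Δ` has a derivation with length at most `n`, cut rank at
most `m` and truth complexity at most `k`. As a cut on `φ` has rank `|φ| + 1`, derivations of cut rank
`0` are the cut-free ones. -/
def Provable (n m k : ℕ) (Γ Δ : Multiset (Fml 0)) : Prop :=
  ∃ Γ' Δ' : Ctx, Γ'.forget = Γ ∧ Δ'.forget = Δ ∧ Der m k n Γ' Δ'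

/-- The hyperexponential function: `hyperexp n 0 = n` and `hyperexp n (m + 1) = 2 ^ hyperexp n m`. -/
def hyperexp (n : ℕ) : ℕ → ℕ
  | 0 => n
  | m + 1 => 2 ^ hyperexp n m

end LPTN

/-!
Cuts are eliminated in a calculus without eigenvariables, in which the right rule for `∀` and the
case distinction `s = 0 ∨ s = S y` have one premiss for every term, so that no substitution into
derivations is needed. Both sides of a sequent are merged into one multiset of signed occurrences,
and each occurrence carries a depth that bounds how often it is analysed further. A truth rule
lowers the depth just as a logical rule does; hence reducing a cut on `T⌜φ⌝` to a cut on `φ` is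
progress, although `φ` may be far more complex than `T⌜φ⌝`, and Gentzen's reduction costs one
exponential for each unit of depth of the cut formulas. In a derivation of length `n` no occurrence
is analysed more than `n` times, so that the length is a bound for the depth; without truth rules
the logical complexity is one as well, and the depth of the cut formulas is then less than the cut
rank. A cut-free derivation is turned back into one with eigenvariables by choosing the premiss of
a fresh variable. The factor 3 stems from the replacement rule in the case that `s = t` and `φ(t)`
are one and the same occurrence.
-/

namespace LPTN

/-! ### Substitution for the free variables -/

namespace Tm

/-- Simultaneous substitution of terms for the free variables of a term. -/
def subst (σ : ℕ → Tm 0) {n : ℕ} : Tm n → Tm n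
  | fv x => lift (σ x)
  | bv i => bv i
  | zero => zero
  | succ t => succ (subst σ t)
  | add s t => add (subst σ s) (subst σ t)
  | mul s t => mul (subst σ s) (subst σ t)

theorem lift_eq_self (t : Tm 0) : lift t = t := by
  induction t with
  | bv i => exact i.elim0
  | _ => simp_all [lift]

theorem inst_lift {n : ℕ} (s t : Tm 0) : inst s (lift t : Tm (n + 1)) = lift t := by
  induction t with
  | bv i => exact i.elim0
  | _ => simp_all [lift, inst]

theorem subst_lift {n : ℕ} (σ : ℕ → Tm 0) (t : Tm 0) :
    subst σ (lift t : Tm n) = lift (subst σ t) := by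
  induction t with
  | fv x => simp [lift, subst, lift_eq_self]
  | bv i => exact i.elim0
  | _ => simp_all [lift, subst]

theorem subst_inst {n : ℕ} (σ : ℕ → Tm 0) (s : Tm 0) (t : Tm (n + 1)) :
    subst σ (inst s t) = inst (subst σ s) (subst σ t) := by
  induction t with
  | fv x => simp [inst, subst, inst_lift]
  | bv i => cases i using Fin.cases <;> simp [inst, subst, subst_lift]
  | _ => simp_all [inst, subst]

theorem subst_congr {n : ℕ} {σ τ : ℕ → Tm 0} (t : Tm n) (h : ∀ x ∈ t.FV, σ x = τ x) :
    subst σ t = subst τ t := by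
  induction t <;> simp_all [subst, FV]

theorem subst_update {n : ℕ} {y : ℕ} {t : Tm n} (hy : y ∉ t.FV) (σ : ℕ → Tm 0) (s : Tm 0) :
    subst (Function.update σ y s) t = subst σ t :=
  subst_congr t fun _ hx => Function.update_of_ne (ne_of_mem_of_not_mem hx hy) _ _

theorem subst_fv {n : ℕ} (t : Tm n) : subst fv t = t := by
  induction t <;> simp_all [subst, lift]

theorem subst_numeral {n : ℕ} (σ : ℕ → Tm 0) (l : ℕ) :
    subst σ (numeral l : Tm n) = numeral l := by
  induction l <;> simp_all [numeral, subst]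

theorem numeral_injective {n : ℕ} : Function.Injective (numeral (n := n))
  | 0, 0, _ => rfl
  | _ + 1, _ + 1, h => congrArg (· + 1) (numeral_injective (succ.inj h))

end Tm

namespace Fml

/-- Simultaneous substitution of terms for the free variables of a formula. -/
def subst (σ : ℕ → Tm 0) : {n : ℕ} → Fml n → Fml n
  | _, bot => bot
  | _, top => top
  | _, eq s t => eq (s.subst σ) (t.subst σ)
  | _, tr t => tr (t.subst σ)
  | _, neg φ => neg (subst σ φ)
  | _, and φ ψ => and (subst σ φ) (subst σ ψ)
  | _, all φ => all (subst σ φ)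

theorem subst_inst (σ : ℕ → Tm 0) (s : Tm 0) : ∀ {n : ℕ} (φ : Fml (n + 1)),
    subst σ (inst s φ) = inst (s.subst σ) (subst σ φ)
  | _, bot => by simp only [inst, subst]
  | _, top => by simp only [inst, subst]
  | _, eq t u => by simp only [inst, subst, Tm.subst_inst]
  | _, tr t => by simp only [inst, subst, Tm.subst_inst]
  | _, neg φ => by simp only [inst, subst, subst_inst σ s φ]
  | _, and φ ψ => by simp only [inst, subst, subst_inst σ s φ, subst_inst σ s ψ]
  | _, all φ => by simp only [inst, subst, subst_inst σ s φ]

theorem complexity_inst (s : Tm 0) : ∀ {n : ℕ} (φ : Fml (n + 1)),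
    (inst s φ).complexity = φ.complexity
  | _, bot => by simp only [inst, complexity]
  | _, top => by simp only [inst, complexity]
  | _, eq _ _ => by simp only [inst, complexity]
  | _, tr _ => by simp only [inst, complexity]
  | _, neg φ => by simp only [inst, complexity, complexity_inst s φ]
  | _, and φ ψ => by
    simp only [inst, complexity, complexity_inst s φ, complexity_inst s ψ]
  | _, all φ => by simp only [inst, complexity, complexity_inst s φ]

theorem subst_congr {σ τ : ℕ → Tm 0} {n : ℕ} (φ : Fml n) (h : ∀ x ∈ φ.FV, σ x = τ x) :
    subst σ φ = subst τ φ := by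
  induction φ with
  | eq s t =>
    simp only [FV, Finset.mem_union] at h
    exact congrArg₂ eq (Tm.subst_congr s fun x hx => h x (.inl hx))
      (Tm.subst_congr t fun x hx => h x (.inr hx))
  | tr t => exact congrArg tr (Tm.subst_congr t h)
  | _ => simp_all [subst, FV]

theorem subst_update {n : ℕ} {y : ℕ} {φ : Fml n} (hy : y ∉ φ.FV) (σ : ℕ → Tm 0) (s : Tm 0) :
    subst (Function.update σ y s) φ = subst σ φ :=
  subst_congr φ fun _ hx => Function.update_of_ne (ne_of_mem_of_not_mem hx hy) _ _

theorem subst_update_inst_fv {y : ℕ} {φ : Fml 1} (hy : y ∉ φ.FV) (σ : ℕ → Tm 0) (s : Tm 0) :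
    (φ.inst (.fv y)).subst (Function.update σ y s) = (φ.subst σ).inst s := by
  rw [subst_inst, subst_update hy, Tm.subst, Tm.lift_eq_self, Function.update_self]

theorem subst_fv {n : ℕ} (φ : Fml n) : subst Tm.fv φ = φ := by
  induction φ <;> simp_all [subst, Tm.subst_fv]

theorem IsSentence.subst_eq {φ : Fml 0} (h : φ.IsSentence) (σ : ℕ → Tm 0) : subst σ φ = φ := by
  rw [IsSentence] at h
  rw [subst_congr (τ := Tm.fv) φ (by simp [h]), subst_fv]

/-- Equations are the formulas that the rules of arithmetic act on. They are not analysed any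
further, so that bounds on their analysis are irrelevant. -/
def IsEquation : Fml 0 → Prop
  | eq _ _ => True
  | _ => False

theorem IsEquation.exists_eq {φ : Fml 0} (h : φ.IsEquation) : ∃ s t, φ = eq s t := by
  cases φ with
  | eq s t => exact ⟨s, t, rfl⟩
  | _ => exact h.elim

end Fml

theorem subst_truthOf (σ : ℕ → Tm 0) (φ : Fml 0) : (truthOf φ).subst σ = truthOf φ := by
  simp only [truthOf, Fml.subst, Tm.subst_numeral]

theorem truthOf_injective : Function.Injective truthOf := fun _ _ h =>
  Fml.code_injective (Tm.numeral_injective (Fml.tr.inj h))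

/-! ### The calculus with premisses for all instances -/

/-- A formula occurrence: `side` is `true` in the antecedent and `false` in the succedent, `tc`
bounds the truth complexity, and `depth` bounds how often the occurrence is analysed. -/
structure Occ where
  side : Bool
  fml : Fml 0
  tc : ℕ
  depth : ℕ

/-- `a.Le b` if `b` is the same signed formula with larger bounds; as equations are not analysed,
their bounds are ignored. -/
def Occ.Le (a b : Occ) : Prop :=
  a.side = b.side ∧ a.fml = b.fml ∧ (a.fml.IsEquation ∨ (a.tc ≤ b.tc ∧ a.depth ≤ b.depth))

/-- The occurrence of a signed formula with the bounds `i` and `d`. -/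
def withBounds (i d : ℕ) (x : Bool × Fml 0) : Occ := ⟨x.1, x.2, i, d⟩

namespace Occ

theorem Le.refl (a : Occ) : a.Le a := ⟨rfl, rfl, .inr ⟨le_rfl, le_rfl⟩⟩

theorem Le.withBounds {i d i' d' : ℕ} (hi : i ≤ i') (hd : d ≤ d') (x : Bool × Fml 0) :
    (withBounds i d x).Le (withBounds i' d' x) := ⟨rfl, rfl, .inr ⟨hi, hd⟩⟩

theorem rel_refl (G : Multiset Occ) : Multiset.Rel Le G G :=
  Multiset.rel_refl_of_refl_on fun a _ => .refl a

theorem rel_withBounds {i d i' d' : ℕ} (hi : i ≤ i') (hd : d ≤ d')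
    (A : Multiset (Bool × Fml 0)) :
    Multiset.Rel Le (A.map (LPTN.withBounds i d)) (A.map (LPTN.withBounds i' d')) :=
  Multiset.rel_map.2 (Multiset.rel_refl_of_refl_on fun x _ => .withBounds hi hd x)

theorem Le.exists_eq_mk {b : Bool} {φ : Fml 0} {i τ d : ℕ} {a : Occ}
    (h : Le ⟨b, φ, i + τ, d + 1⟩ a) (hφ : ¬ φ.IsEquation) :
    ∃ i' d', i ≤ i' ∧ d ≤ d' ∧ a = ⟨b, φ, i' + τ, d' + 1⟩ := by
  obtain ⟨b', φ', i', d'⟩ := a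
  obtain ⟨rfl, rfl, h⟩ := h
  obtain ⟨hi, hd⟩ : i + τ ≤ i' ∧ d + 1 ≤ d' := h.resolve_left hφ
  exact ⟨i' - τ, d' - 1, by omega, by omega, by simp only [mk.injEq, true_and]; omega⟩

end Occ

open Fml in
/-- The invertible rules: `Decomp b φ τ J` says that the formula `φ` on the side `b` may be replaced
by the signed formulas in any of the multisets in `J`, one for each premiss; `τ` is the amount by
which the truth complexity decreases. -/
inductive Decomp : Bool → Fml 0 → ℕ → Set (Multiset (Bool × Fml 0)) → Prop
  | neg (b : Bool) (φ : Fml 0) : Decomp b (neg φ) 0 {{(!b, φ)}}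
  | andL (φ ψ : Fml 0) : Decomp true (and φ ψ) 0 {{(true, φ), (true, ψ)}}
  | andR (φ ψ : Fml 0) : Decomp false (and φ ψ) 0 {{(false, φ)}, {(false, ψ)}}
  | allR (φ : Fml 1) : Decomp false (all φ) 0 (Set.range fun s => {(false, φ.inst s)})
  | tr (b : Bool) (φ : Fml 0) (hφ : φ.IsSentence) : Decomp b (truthOf φ) 1 {{(b, φ)}}

namespace Decomp

variable {b : Bool} {φ : Fml 0} {τ τ' : ℕ} {J J' : Set (Multiset (Bool × Fml 0))}

theorem unique (h : Decomp b φ τ J) (h' : Decomp b φ τ' J') : τ = τ' ∧ J = J' := by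
  cases h with
  | tr b φ hφ =>
    generalize hχ : truthOf φ = χ at h'
    cases h' with
    | tr _ ψ => exact ⟨rfl, by rw [truthOf_injective hχ]⟩
    | _ => simp [truthOf] at hχ
  | _ => cases h'; exact ⟨rfl, rfl⟩

theorem not_isEquation (h : Decomp b φ τ J) : ¬ φ.IsEquation := by
  cases h <;> exact id

theorem ne_all {φ : Fml 1} : ¬ Decomp true (.all φ) τ J := by
  generalize hχ : Fml.all φ = χ
  rintro (_ | _) <;> simp [truthOf] at hχ

end Decomp

open Fml Tm in
/-- The equations that the rules of equality and arithmetic without principal formula add to the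
antecedent. -/
inductive ArithAxiom : Fml 0 → Prop
  | eq1 (t : Tm 0) : ArithAxiom (eq t t)
  | q4 (s : Tm 0) : ArithAxiom (eq (add s zero) s)
  | q5 (s t : Tm 0) : ArithAxiom (eq (add s (succ t)) (succ (add s t)))
  | q6 (s : Tm 0) : ArithAxiom (eq (mul s zero) zero)
  | q7 (s t : Tm 0) : ArithAxiom (eq (mul s (succ t)) (add (mul s t) s))

theorem ArithAxiom.subst {φ : Fml 0} (h : ArithAxiom φ) (σ : ℕ → Tm 0) :
    ArithAxiom (φ.subst σ) := by
  cases h <;> simp only [Fml.subst, Tm.subst] <;> constructor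

open Fml Tm in
/-- The rules of equality and arithmetic: the set of the principal equations, and the set of the
equations that are added to the antecedent in the premisses. -/
inductive ArithRule : Set (Fml 0) → Set (Fml 0) → Prop
  | ax {φ : Fml 0} (h : ArithAxiom φ) : ArithRule ∅ {φ}
  | eq2 (s t : Tm 0) (a b : Tm 1) :
      ArithRule {eq s t, eq (Tm.inst t a) (Tm.inst t b)} {eq (Tm.inst s a) (Tm.inst s b)}
  | q1 (s : Tm 0) : ArithRule {eq (succ s) zero} ∅
  | q2 (s t : Tm 0) : ArithRule {eq (succ s) (succ t)} {eq s t}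
  | q3 (s : Tm 0) : ArithRule ∅ (insert (eq s zero) (Set.range fun u => eq s (succ u)))

theorem ArithRule.isEquation {P J : Set (Fml 0)} (h : ArithRule P J) {e : Fml 0} (he : e ∈ P) :
    e.IsEquation := by
  cases h with
  | ax | q3 => exact he.elim
  | eq2 => obtain rfl | rfl := he <;> trivial
  | q1 | q2 => obtain rfl := he; trivial

theorem ArithRule.isEquation_premiss {P J : Set (Fml 0)} (h : ArithRule P J) {e : Fml 0}
    (he : e ∈ J) : e.IsEquation := by
  cases h with
  | ax h => obtain rfl := he; cases h <;> trivial
  | q1 => exact he.elim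
  | eq2 | q2 => obtain rfl := he; trivial
  | q3 => obtain rfl | ⟨u, rfl⟩ := he <;> trivial

open Fml in
/-- `InstDer r n G`: the sequent `G` of signed formula occurrences has a derivation of length at
most `n` in the calculus that has a premiss for every term in place of an eigenvariable, and all its
cut formulas have depth less than `r`. -/
inductive InstDer (r : ℕ) : ℕ → Multiset Occ → Prop
  | ref {n : ℕ} {G : Multiset Occ} {s t : Tm 0} {i d i' d' : ℕ}
      (hL : ⟨true, eq s t, i, d⟩ ∈ G) (hR : ⟨false, eq s t, i', d'⟩ ∈ G) : InstDer r n G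
  | arith {n n₀ : ℕ} {G : Multiset Occ} {P J : Set (Fml 0)} (hPJ : ArithRule P J)
      (hP : ∀ e ∈ P, ∃ i d, ⟨true, e, i, d⟩ ∈ G) (h₀ : ∀ e ∈ J, n₀ < n)
      (D : ∀ e ∈ J, InstDer r n₀ (⟨true, e, 0, 0⟩ ::ₘ G)) : InstDer r n G
  | allL {n n₀ : ℕ} {G : Multiset Occ} {φ : Fml 1} {i d : ℕ} (s : Tm 0)
      (hG : ⟨true, all φ, i, d + 1⟩ ∈ G) (h₀ : n₀ < n)
      (D : InstDer r n₀ (⟨true, φ.inst s, i, d⟩ ::ₘ G)) : InstDer r n G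
  | inv {n n₀ : ℕ} {G : Multiset Occ} {b : Bool} {φ : Fml 0} {τ : ℕ}
      {J : Set (Multiset (Bool × Fml 0))} (hJ : Decomp b φ τ J) (i d : ℕ) (h₀ : n₀ < n)
      (D : ∀ A ∈ J, InstDer r n₀ (A.map (withBounds i d) + G)) :
      InstDer r n (⟨b, φ, i + τ, d + 1⟩ ::ₘ G)
  | cut {n n₀ n₁ : ℕ} {G : Multiset Occ} {φ : Fml 0} {i d : ℕ} (h₀ : n₀ < n) (h₁ : n₁ < n)
      (hd : d < r) (D₀ : InstDer r n₀ (⟨false, φ, i, d⟩ ::ₘ G))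
      (D₁ : InstDer r n₁ (⟨true, φ, i, d⟩ ::ₘ G)) : InstDer r n G

/-! ### Cut elimination -/

namespace InstDer

variable {r : ℕ}

theorem mono {n n' : ℕ} {G : Multiset Occ} (D : InstDer r n G) (h : n ≤ n') : InstDer r n' G := by
  cases D with
  | ref hL hR => exact ref hL hR
  | arith hPJ hP h₀ D => exact arith hPJ hP (fun e he => (h₀ e he).trans_le h) D
  | allL s hG h₀ D => exact allL s hG (h₀.trans_le h) D
  | inv hJ i d h₀ D => exact inv hJ i d (h₀.trans_le h) D
  | cut h₀ h₁ hd D₀ D₁ => exact cut (h₀.trans_le h) (h₁.trans_le h) hd D₀ D₁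

theorem weaken {n : ℕ} {G H : Multiset Occ} (D : InstDer r n G) (h : G ≤ H) : InstDer r n H := by
  induction D generalizing H with
  | ref hL hR => exact ref (Multiset.mem_of_le h hL) (Multiset.mem_of_le h hR)
  | arith hPJ hP h₀ _ ih =>
    exact arith hPJ (fun e he => (hP e he).imp fun i => .imp fun d => Multiset.mem_of_le h) h₀
      fun e he => ih e he (Multiset.cons_le_cons _ h)
  | allL s hG h₀ _ ih =>
    exact allL s (Multiset.mem_of_le h hG) h₀ (ih (Multiset.cons_le_cons _ h))
  | inv hJ i d h₀ _ ih =>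
    obtain ⟨K, rfl⟩ := Multiset.le_iff_exists_add.1 h
    rw [Multiset.cons_add]
    exact inv hJ i d h₀ fun A hA => ih A hA (by gcongr; exact Multiset.le_add_right ..)
  | cut h₀ h₁ hd _ _ ih₀ ih₁ =>
    exact cut h₀ h₁ hd (ih₀ (Multiset.cons_le_cons _ h)) (ih₁ (Multiset.cons_le_cons _ h))

theorem raise {n : ℕ} {G G' : Multiset Occ} (D : InstDer r n G) (h : Multiset.Rel Occ.Le G G') :
    InstDer r n G' := by
  have exists_mem : ∀ {G G' : Multiset Occ} {b φ i d}, Multiset.Rel Occ.Le G G' →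
      ⟨b, φ, i, d⟩ ∈ G → ∃ i' d', ⟨b, φ, i', d'⟩ ∈ G' := by
    intro G G' b φ i d h hG
    obtain ⟨⟨_, _, i', d'⟩, hG', rfl, rfl, -⟩ := Multiset.exists_mem_of_rel_of_mem h hG
    exact ⟨i', d', hG'⟩
  induction D generalizing G' with
  | ref hL hR =>
    obtain ⟨i, d, hL⟩ := exists_mem h hL
    obtain ⟨i', d', hR⟩ := exists_mem h hR
    exact ref hL hR
  | arith hPJ hP h₀ _ ih =>
    refine arith hPJ (fun e he => ?_) h₀ fun e he => ih e he (.cons (.refl _) h)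
    obtain ⟨i, d, hG⟩ := hP e he
    exact exists_mem h hG
  | @allL _ _ _ φ i d s hG h₀ _ ih =>
    obtain ⟨a, ha, hle⟩ := Multiset.exists_mem_of_rel_of_mem h hG
    obtain ⟨i', d', hi, hd, rfl⟩ := Occ.Le.exists_eq_mk (τ := 0) hle id
    exact allL s ha h₀ (ih (.cons (.withBounds hi hd (true, φ.inst s)) h))
  | inv hJ i d h₀ _ ih =>
    obtain ⟨a, G', hle, hG, rfl⟩ := Multiset.rel_cons_left.1 h
    obtain ⟨i', d', hi, hd, rfl⟩ := hle.exists_eq_mk hJ.not_isEquation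
    exact inv hJ i' d' h₀ fun A hA => ih A hA ((Occ.rel_withBounds hi hd A).add hG)
  | cut h₀ h₁ hd _ _ ih₀ ih₁ =>
    exact cut h₀ h₁ hd (ih₀ (.cons (.refl _) h)) (ih₁ (.cons (.refl _) h))

/-- Cut reduction and inversion trace an occurrence `a` upwards through a derivation and replace it
by `B`; they only differ in what is done at the inferences in which `a` is principal. -/
theorem replace {n c : ℕ} {G B : Multiset Occ} {a : Occ}
    (ha : a.side = true → ¬ a.fml.IsEquation)
    (href : ∀ {G s t i d}, a.side = false → a.fml = .eq s t → ⟨true, .eq s t, i, d⟩ ∈ G →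
      InstDer r c (B + G))
    (hall : ∀ {n G φ i d} (s : Tm 0), a = ⟨true, .all φ, i, d + 1⟩ →
      InstDer r (n + c) (⟨true, φ.inst s, i, d⟩ ::ₘ (B + G)) → InstDer r (n + c + 1) (B + G))
    (hinv : ∀ {n G b φ τ J i d}, Decomp b φ τ J → a = ⟨b, φ, i + τ, d + 1⟩ →
      (∀ A ∈ J, InstDer r n (A.map (withBounds i d) + G)) → InstDer r (n + c) (B + G))
    (D : InstDer r n (a ::ₘ G)) : InstDer r (n + c) (B + G) := by
  have mem_of_ne : ∀ {G : Multiset Occ} {x : Occ}, x ∈ a ::ₘ G → x ≠ a → x ∈ B + G := fun h hne =>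
    Multiset.mem_add.2 (.inr ((Multiset.mem_cons.1 h).resolve_left hne))
  generalize hH : a ::ₘ G = H at D
  induction D generalizing G with
  | @ref n _ s t i d i' d' hL hR =>
    subst hH
    have hne : ⟨true, .eq s t, i, d⟩ ≠ a := by rintro rfl; exact ha rfl trivial
    rcases Multiset.mem_cons.1 hR with rfl | hR
    · exact (href rfl rfl ((Multiset.mem_cons.1 hL).resolve_left hne)).mono (Nat.le_add_left ..)
    · exact ref (mem_of_ne hL hne) (Multiset.mem_add.2 (.inr hR))
  | arith hPJ hP h₀ D ih =>
    subst hH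
    refine arith hPJ (fun e he => ?_) (fun e he => Nat.add_lt_add_right (h₀ e he) c) fun e he => ?_
    · obtain ⟨i, d, hG⟩ := hP e he
      exact ⟨i, d, mem_of_ne hG (by rintro rfl; exact ha rfl (hPJ.isEquation he))⟩
    · simpa only [Multiset.add_cons] using ih e he (Multiset.cons_swap ..)
  | @allL n n₀ _ φ i d s hG h₀ D ih =>
    subst hH
    have E := ih (Multiset.cons_swap ..)
    rw [Multiset.add_cons] at E
    by_cases h : (⟨true, .all φ, i, d + 1⟩ : Occ) = a
    · exact (hall s h.symm E).mono (by omega)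
    · exact allL s (mem_of_ne hG h) (Nat.add_lt_add_right h₀ c) E
  | inv hJ i d h₀ D ih =>
    rcases Multiset.cons_eq_cons.1 hH with ⟨rfl, rfl⟩ | ⟨-, G', rfl, rfl⟩
    · exact (hinv hJ rfl D).mono (by omega)
    · rw [Multiset.add_cons]
      refine inv hJ i d (Nat.add_lt_add_right h₀ c) fun A hA => ?_
      rw [add_left_comm]
      exact ih A hA (Multiset.add_cons ..).symm
  | cut h₀ h₁ hd D₀ D₁ ih₀ ih₁ =>
    subst hH
    have E₀ := ih₀ (Multiset.cons_swap ..)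
    have E₁ := ih₁ (Multiset.cons_swap ..)
    rw [Multiset.add_cons] at E₀ E₁
    exact cut (Nat.add_lt_add_right h₀ c) (Nat.add_lt_add_right h₁ c) hd E₀ E₁

theorem inversion {n : ℕ} {G : Multiset Occ} {b : Bool} {φ : Fml 0} {τ i d : ℕ}
    {J : Set (Multiset (Bool × Fml 0))} (hJ : Decomp b φ τ J) {A : Multiset (Bool × Fml 0)}
    (hA : A ∈ J) (D : InstDer r n (⟨b, φ, i + τ, d + 1⟩ ::ₘ G)) :
    InstDer r n (A.map (withBounds i d) + G) := by
  refine D.replace (c := 0) (fun _ => hJ.not_isEquation) (fun _ hφ _ => ?_) (fun s h => ?_)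
    fun hJ' h D => ?_
  · obtain rfl : φ = _ := hφ
    exact absurd trivial hJ.not_isEquation
  · obtain ⟨rfl, rfl, -⟩ := Occ.mk.injEq .. ▸ h
    exact absurd hJ Decomp.ne_all
  · obtain ⟨rfl, rfl, hi, hd⟩ := Occ.mk.injEq .. ▸ h
    obtain ⟨rfl, rfl⟩ := hJ.unique hJ'
    obtain rfl := Nat.add_right_cancel hi
    obtain rfl := Nat.add_right_cancel hd
    exact D A hA

theorem contract_of_le {n : ℕ} {A G : Multiset Occ}
    (h : ∀ {a : Occ} {G : Multiset Occ}, a ∈ G → InstDer r n (a ::ₘ G) → InstDer r n G)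
    (hA : A ≤ G) (D : InstDer r n (A + G)) : InstDer r n G := by
  induction A using Multiset.induction with
  | empty => simpa using D
  | cons a A ih =>
    rw [Multiset.cons_add] at D
    exact ih ((Multiset.le_cons_self A a).trans hA)
      (h (Multiset.mem_add.2 (.inr (Multiset.mem_of_le hA (Multiset.mem_cons_self a A)))) D)

theorem contract {n : ℕ} {G : Multiset Occ} {a : Occ} (ha : a ∈ G)
    (D : InstDer r n (a ::ₘ G)) : InstDer r n G := by
  induction n using Nat.strong_induction_on generalizing a G with
  | _ n ih =>
  have mem : ∀ {b : Occ}, b ∈ a ::ₘ G → b ∈ G := fun h =>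
    (Multiset.mem_cons.1 h).elim (fun h => h ▸ ha) id
  have ih_cons : ∀ {n₀ b}, n₀ < n → InstDer r n₀ (b ::ₘ a ::ₘ G) → InstDer r n₀ (b ::ₘ G) :=
    fun h₀ D => ih _ h₀ (Multiset.mem_cons_of_mem ha) (Multiset.cons_swap .. ▸ D)
  generalize hH : a ::ₘ G = H at D
  cases D with
  | ref hL hR => subst hH; exact ref (mem hL) (mem hR)
  | arith hPJ hP h₀ D =>
    subst hH
    exact arith hPJ (fun e he => (hP e he).imp fun i => .imp fun d => mem) h₀
      fun e he => ih_cons (h₀ e he) (D e he)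
  | allL s hG h₀ D => subst hH; exact allL s (mem hG) h₀ (ih_cons h₀ D)
  | inv hJ i d h₀ D =>
    rcases Multiset.cons_eq_cons.1 hH with ⟨rfl, rfl⟩ | ⟨hne, G', rfl, rfl⟩
    · obtain ⟨G, rfl⟩ := Multiset.exists_cons_of_mem ha
      refine inv hJ i d h₀ fun A hA => ?_
      have E := D A hA
      rw [Multiset.add_cons] at E
      exact contract_of_le (ih _ h₀) (Multiset.le_add_right ..) (inversion hJ hA E)
    · have ha := (Multiset.mem_cons.1 ha).resolve_left hne
      refine inv hJ i d h₀ fun A hA => ih _ h₀ (Multiset.mem_add.2 (.inr ha)) ?_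
      rw [← Multiset.add_cons]
      exact D A hA
  | cut h₀ h₁ hd D₀ D₁ => subst hH; exact cut h₀ h₁ hd (ih_cons h₀ D₀) (ih_cons h₁ D₁)

theorem contract_self {n : ℕ} {G : Multiset Occ} (D : InstDer r n (G + G)) : InstDer r n G :=
  D.contract_of_le contract le_rfl

theorem strengthen {n : ℕ} {G : Multiset Occ} {φ : Fml 0} {i d : ℕ} (hφ : ¬ φ.IsEquation)
    (hJ : ∀ j d' τ J, Decomp false φ τ J → ¬ (i = j + τ ∧ d = d' + 1))
    (D : InstDer r n (⟨false, φ, i, d⟩ ::ₘ G)) : InstDer r n G := by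
  rw [← zero_add G]
  refine D.replace (c := 0) (by simp) (fun _ h _ => ?_) (by simp) fun hJ' h _ => ?_
  · obtain rfl : φ = _ := h
    exact absurd trivial hφ
  · obtain ⟨rfl, rfl, hi, hd⟩ := Occ.mk.injEq .. ▸ h
    exact absurd ⟨hi, hd⟩ (hJ _ _ _ _ hJ')

theorem strengthen_initial {n : ℕ} {G : Multiset Occ} {a : Occ} (ha : ¬ a.fml.IsEquation)
    (D : InstDer r 0 (a ::ₘ G)) : InstDer r n G := by
  have mem : ∀ {b i d} {e : Fml 0}, e.IsEquation → ⟨b, e, i, d⟩ ∈ a ::ₘ G → ⟨b, e, i, d⟩ ∈ G :=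
    fun he h => (Multiset.mem_cons.1 h).resolve_left (by rintro rfl; exact ha he)
  generalize hH : a ::ₘ G = H at D
  cases D with
  | ref hL hR => subst hH; exact ref (mem (by trivial) hL) (mem (by trivial) hR)
  | arith hPJ hP h₀ D =>
    subst hH
    exact arith (n₀ := 0) hPJ
      (fun e he => (hP e he).imp fun i => .imp fun d => mem (hPJ.isEquation he))
      (fun e he => absurd (h₀ e he) (Nat.not_lt_zero _))
      fun e he => absurd (h₀ e he) (Nat.not_lt_zero _)
  | allL s hG h₀ D => exact absurd h₀ (Nat.not_lt_zero _)
  | inv hJ i d h₀ D => exact absurd h₀ (Nat.not_lt_zero _)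
  | cut h₀ h₁ hd D₀ D₁ => exact absurd h₀ (Nat.not_lt_zero _)

theorem cut_eq {n₀ n₁ : ℕ} {G : Multiset Occ} {s t : Tm 0} {i d i' d' : ℕ}
    (D₀ : InstDer r n₀ (⟨false, .eq s t, i, d⟩ ::ₘ G))
    (D₁ : InstDer r n₁ (⟨true, .eq s t, i', d'⟩ ::ₘ G)) : InstDer r (n₀ + n₁) G := by
  refine contract_self (D₀.replace (by simp) (fun {H u v j e} _ h hH => ?_) (by simp)
    fun hJ h _ => ?_)
  · obtain ⟨rfl, rfl⟩ := Fml.eq.inj h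
    have E := D₁.raise (.cons (b := ⟨true, .eq s t, j, e⟩) ⟨rfl, rfl, .inl trivial⟩
      (Occ.rel_refl G))
    refine contract (Multiset.mem_add.2 (.inr hH)) (E.weaken ?_)
    exact Multiset.cons_le_cons _ (Multiset.le_add_right ..)
  · obtain ⟨rfl, rfl, -⟩ := Occ.mk.injEq .. ▸ h
    exact absurd trivial hJ.not_isEquation

theorem cut_neg {n₀ n₁ : ℕ} {G : Multiset Occ} {φ : Fml 0} {i d : ℕ} (hd : d < r)
    (D₀ : InstDer r n₀ (⟨false, .neg φ, i, d + 1⟩ ::ₘ G))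
    (D₁ : InstDer r n₁ (⟨true, .neg φ, i, d + 1⟩ ::ₘ G)) : InstDer r (n₀ + n₁ + 1) G :=
  cut (n₀ := n₁) (n₁ := n₀) (by omega) (by omega) hd
    (by simpa [withBounds] using D₁.inversion (.neg ..) rfl)
    (by simpa [withBounds] using D₀.inversion (.neg ..) rfl)

theorem cut_and {n₀ n₁ : ℕ} {G : Multiset Occ} {φ ψ : Fml 0} {i d : ℕ} (hd : d < r)
    (D₀ : InstDer r n₀ (⟨false, .and φ ψ, i, d + 1⟩ ::ₘ G))
    (D₁ : InstDer r n₁ (⟨true, .and φ ψ, i, d + 1⟩ ::ₘ G)) : InstDer r (n₀ + n₁ + 1) G := by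
  rcases Nat.eq_zero_or_pos n₀ with rfl | h₀
  · exact D₀.strengthen_initial id
  rcases Nat.eq_zero_or_pos n₁ with rfl | h₁
  · exact D₁.strengthen_initial id
  have Eφ : InstDer r n₀ (⟨false, φ, i, d⟩ ::ₘ G) := by
    simpa [withBounds] using D₀.inversion (.andR ..) (.inl rfl)
  have Eψ : InstDer r n₀ (⟨false, ψ, i, d⟩ ::ₘ G) := by
    simpa [withBounds] using D₀.inversion (.andR ..) (.inr rfl)
  have E : InstDer r n₁ (⟨true, φ, i, d⟩ ::ₘ ⟨true, ψ, i, d⟩ ::ₘ G) := by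
    simpa [withBounds] using D₁.inversion (.andL ..) rfl
  refine cut (n₁ := max n₀ n₁ + 1) (by omega) (by omega) hd Eψ ?_
  exact cut (by omega) (by omega) hd
    (Eφ.weaken (Multiset.cons_le_cons _ (Multiset.le_cons_self ..))) E

theorem cut_all {n₀ n₁ : ℕ} {G : Multiset Occ} {φ : Fml 1} {i d : ℕ} (hd : d < r)
    (D₀ : InstDer r n₀ (⟨false, .all φ, i, d + 1⟩ ::ₘ G))
    (D₁ : InstDer r n₁ (⟨true, .all φ, i, d + 1⟩ ::ₘ G)) : InstDer r (n₁ + n₀) G := by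
  have E : ∀ s, InstDer r n₀ (⟨false, φ.inst s, i, d⟩ ::ₘ G) := fun s => by
    simpa [withBounds] using D₀.inversion (.allR φ) ⟨s, rfl⟩
  refine contract_self (D₁.replace (fun _ => id) (by simp) (fun {n H ψ j e} s h D => ?_)
    fun hJ h _ => ?_)
  · simp only [Occ.mk.injEq, Fml.all.injEq, true_and, Nat.add_right_cancel_iff] at h
    obtain ⟨rfl, rfl, rfl⟩ := h
    refine cut (by omega) (by omega) hd ((E s).weaken ?_) D
    exact Multiset.cons_le_cons _ (Multiset.le_add_right ..)
  · obtain ⟨rfl, rfl, -⟩ := Occ.mk.injEq .. ▸ h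
    exact absurd hJ Decomp.ne_all

theorem cut_truthOf {n₀ n₁ : ℕ} {G : Multiset Occ} {φ : Fml 0} {i d : ℕ} (hφ : φ.IsSentence)
    (hd : d < r) (D₀ : InstDer r n₀ (⟨false, truthOf φ, i + 1, d + 1⟩ ::ₘ G))
    (D₁ : InstDer r n₁ (⟨true, truthOf φ, i + 1, d + 1⟩ ::ₘ G)) : InstDer r (n₀ + n₁ + 1) G :=
  cut (n₀ := n₀) (n₁ := n₁) (by omega) (by omega) hd
    (by simpa [withBounds] using D₀.inversion (.tr _ _ hφ) rfl)
    (by simpa [withBounds] using D₁.inversion (.tr _ _ hφ) rfl)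

theorem cut_reduce {n₀ n₁ : ℕ} {G : Multiset Occ} {φ : Fml 0} {i : ℕ}
    (D₀ : InstDer r n₀ (⟨false, φ, i, r⟩ ::ₘ G)) (D₁ : InstDer r n₁ (⟨true, φ, i, r⟩ ::ₘ G)) :
    InstDer r (n₀ + n₁ + 1) G := by
  by_cases hφ : φ.IsEquation
  · obtain ⟨s, t, rfl⟩ := hφ.exists_eq
    exact (D₀.cut_eq D₁).mono (Nat.le_succ _)
  by_cases hJ : ∃ j d τ J, Decomp false φ τ J ∧ i = j + τ ∧ r = d + 1
  · obtain ⟨j, d, τ, J, hJ, rfl, rfl⟩ := hJ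
    cases hJ with
    | neg => exact cut_neg d.lt_succ_self D₀ D₁
    | andR => exact cut_and d.lt_succ_self D₀ D₁
    | allR => exact (cut_all d.lt_succ_self D₀ D₁).mono (by omega)
    | tr _ _ hψ => exact cut_truthOf hψ d.lt_succ_self D₀ D₁
  · push Not at hJ
    exact (D₀.strengthen hφ fun j d τ J h ⟨hi, hd⟩ => hJ j d τ J h hi hd).mono (by omega)

theorem reduce_rank {n : ℕ} {G : Multiset Occ} (D : InstDer (r + 1) n G) :
    InstDer r (2 ^ n - 1) G := by
  have hlt : ∀ {n₀ n : ℕ}, n₀ < n → 2 ^ n₀ - 1 < 2 ^ n - 1 := fun {n₀ n} h => by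
    have := Nat.pow_lt_pow_right (a := 2) (by omega) h
    have := Nat.one_le_two_pow (n := n₀)
    omega
  induction D with
  | ref hL hR => exact ref hL hR
  | arith hPJ hP h₀ _ ih => exact arith hPJ hP (fun e he => hlt (h₀ e he)) ih
  | allL s hG h₀ _ ih => exact allL s hG (hlt h₀) ih
  | inv hJ i d h₀ _ ih => exact inv hJ i d (hlt h₀) ih
  | @cut n n₀ n₁ G φ i d h₀ h₁ hd D₀ D₁ ih₀ ih₁ =>
    rcases Nat.lt_succ_iff_lt_or_eq.1 hd with hd | rfl
    · exact cut (hlt h₀) (hlt h₁) hd ih₀ ih₁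
    · refine (cut_reduce ih₀ ih₁).mono ?_
      obtain ⟨n, rfl⟩ := Nat.exists_eq_succ_of_ne_zero (Nat.ne_zero_of_lt h₀)
      have e₀ := Nat.pow_le_pow_right (n := 2) (by omega) (Nat.lt_succ_iff.1 h₀)
      have e₁ := Nat.pow_le_pow_right (n := 2) (by omega) (Nat.lt_succ_iff.1 h₁)
      have := Nat.one_le_two_pow (n := n₀)
      have := Nat.one_le_two_pow (n := n₁)
      rw [Nat.succ_eq_add_one, pow_succ]
      omega

end InstDer

theorem hyperexp_two_pow (n m : ℕ) : hyperexp (2 ^ n) m = hyperexp n (m + 1) := by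
  induction m with
  | zero => rfl
  | succ m ih => rw [hyperexp, ih]; rfl

theorem InstDer.cut_elimination {r n : ℕ} {G : Multiset Occ} (D : InstDer r n G) :
    InstDer 0 (hyperexp n r) G := by
  induction r generalizing n with
  | zero => exact D
  | succ r ih =>
    rw [← hyperexp_two_pow]
    exact ih (D.reduce_rank.mono (Nat.sub_le _ _))

/-! ### From eigenvariables to premisses for all instances -/

/-- `δ n c` bounds the depth to which a formula of complexity `c` is analysed in a derivation of
length `n`, if that is part of a derivation of length `N`, cut rank `m` and truth complexity `k`;
the cut formulas then have depth less than `r`. -/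
structure DepthBound (m k N r : ℕ) (δ : ℕ → ℕ → ℕ) : Prop where
  mono {n n' : ℕ} (c : ℕ) : n ≤ n' → δ n c ≤ δ n' c
  step {n n' c c' : ℕ} : n < n' → c < c' → δ n c < δ n' c'
  truth {n n' : ℕ} (c : ℕ) : 1 ≤ k → n < n' → δ n c < δ n' 0
  cut {n c : ℕ} : n < N → c + 1 ≤ m → δ n c < r

theorem DepthBound.length (m k n : ℕ) : DepthBound m k n n fun n _ => n :=
  ⟨fun _ h => h, fun h _ => h, fun _ _ h => h, fun h _ => h⟩

theorem DepthBound.complexity (m n : ℕ) : DepthBound m 0 n m fun _ c => c :=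
  ⟨fun _ _ => le_rfl, fun _ h => h, fun _ h => absurd h (by omega), fun _ h => h⟩

/-- The occurrence, in a derivation of length `n`, that corresponds to a formula with its truth
complexity after the substitution `σ`. -/
def occ (δ : ℕ → ℕ → ℕ) (σ : ℕ → Tm 0) (n : ℕ) (b : Bool) (a : Fml 0 × ℕ) : Occ :=
  ⟨b, a.1.subst σ, a.2, δ n a.1.complexity⟩

/-- The sequent of signed occurrences that corresponds to `Γ ⇒ Δ` after the substitution `σ`. -/
def occs (δ : ℕ → ℕ → ℕ) (σ : ℕ → Tm 0) (n : ℕ) (Γ Δ : Ctx) : Multiset Occ :=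
  Γ.map (occ δ σ n true) + Δ.map (occ δ σ n false)

theorem Ctx2.fresh_right {y : ℕ} {Γ : Ctx2} (h : Γ.join.Fresh y) : Γ.right.Fresh y := by
  rw [Ctx.Fresh, Ctx2.join, Multiset.forall_mem_map_iff] at h
  rwa [Ctx.Fresh, Ctx2.right, Multiset.forall_mem_map_iff]

section

variable {m k N r : ℕ} {δ : ℕ → ℕ → ℕ} {σ : ℕ → Tm 0} {n n₀ n₁ : ℕ} {Γ Δ : Ctx} {Θ Λ : Ctx2}

theorem occs_cons_left (a : Fml 0 × ℕ) :
    occs δ σ n (a ::ₘ Γ) Δ = occ δ σ n true a ::ₘ occs δ σ n Γ Δ := by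
  simp only [occs, Multiset.map_cons, Multiset.cons_add]

theorem occs_cons_right (a : Fml 0 × ℕ) :
    occs δ σ n Γ (a ::ₘ Δ) = occ δ σ n false a ::ₘ occs δ σ n Γ Δ := by
  simp only [occs, Multiset.map_cons, Multiset.add_cons]

theorem occs_update {y : ℕ} (hΓ : Γ.Fresh y) (hΔ : Δ.Fresh y) (s : Tm 0) :
    occs δ (Function.update σ y s) n Γ Δ = occs δ σ n Γ Δ := by
  have map_occ : ∀ {Γ : Ctx} (b : Bool), Γ.Fresh y →
      Γ.map (occ δ (Function.update σ y s) n b) = Γ.map (occ δ σ n b) := fun b hΓ =>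
    Multiset.map_congr rfl fun a ha => by rw [occ, occ, Fml.subst_update (hΓ a ha)]
  rw [occs, map_occ true hΓ, map_occ false hΔ, occs]

theorem Occ.rel_cons {b : Bool} {φ : Fml 0} {i d i' d' : ℕ} {G G' : Multiset Occ} (hi : i ≤ i')
    (hd : d ≤ d') (h : Multiset.Rel Occ.Le G G') :
    Multiset.Rel Occ.Le (⟨b, φ, i, d⟩ ::ₘ G) (⟨b, φ, i', d'⟩ ::ₘ G') :=
  .cons ⟨rfl, rfl, .inr ⟨hi, hd⟩⟩ h

theorem Occ.rel_cons_isEquation {b : Bool} {φ : Fml 0} (hφ : φ.IsEquation) {i d i' d' : ℕ}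
    {G G' : Multiset Occ} (h : Multiset.Rel Occ.Le G G') :
    Multiset.Rel Occ.Le (⟨b, φ, i, d⟩ ::ₘ G) (⟨b, φ, i', d'⟩ ::ₘ G') :=
  .cons ⟨rfl, rfl, .inl hφ⟩ h

theorem InstDer.arith_of_rel {G G' : Multiset Occ} {P : Set (Fml 0)} {e : Fml 0} {i d : ℕ}
    (hP : ArithRule P {e}) (hG : ∀ e ∈ P, ∃ i d, ⟨true, e, i, d⟩ ∈ G) (h₀ : n₀ < n)
    (hG' : Multiset.Rel Occ.Le G' G) (D : InstDer r n₀ (⟨true, e, i, d⟩ ::ₘ G')) :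
    InstDer r n G := by
  refine .arith hP hG (fun _ _ => h₀) ?_
  rintro _ rfl
  exact D.raise (Occ.rel_cons_isEquation (hP.isEquation_premiss rfl) hG')

namespace DepthBound

theorem rel_map {α : Type*} (hδ : DepthBound m k N r δ) (h : n₀ ≤ n) (b : Bool)
    {f g : α → Fml 0 × ℕ} (hfg : ∀ x, (f x).1 = (g x).1 ∧ (f x).2 ≤ (g x).2) (M : Multiset α) :
    Multiset.Rel Occ.Le ((M.map f).map (occ δ σ n₀ b)) ((M.map g).map (occ δ σ n b)) := by
  rw [Multiset.map_map, Multiset.map_map, Multiset.rel_map]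
  refine Multiset.rel_refl_of_refl_on fun x _ => ⟨rfl, ?_, .inr ⟨(hfg x).2, ?_⟩⟩
  · simp only [occ, Function.comp_apply, (hfg x).1]
  · simpa only [occ, Function.comp_apply, (hfg x).1] using hδ.mono _ h

theorem rel_occs (hδ : DepthBound m k N r δ) (h : n₀ ≤ n) :
    Multiset.Rel Occ.Le (occs δ σ n₀ Γ Δ) (occs δ σ n Γ Δ) := by
  have rel := fun b Γ => hδ.rel_map (σ := σ) h b (f := id) (fun _ => ⟨rfl, le_rfl⟩) Γ
  simp only [Multiset.map_id] at rel
  exact (rel true Γ).add (rel false Δ)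

theorem rel_left (hδ : DepthBound m k N r δ) (h : n₀ ≤ n) (Θ Λ : Ctx2) :
    Multiset.Rel Occ.Le (occs δ σ n₀ Θ.left Λ.left) (occs δ σ n Θ.join Λ.join) :=
  have rel b := hδ.rel_map (σ := σ) h b (f := fun a : Fml 0 × ℕ × ℕ => (a.1, a.2.1))
    (g := fun a => (a.1, max a.2.1 a.2.2)) fun _ => ⟨rfl, le_max_left ..⟩
  (rel true Θ).add (rel false Λ)

theorem rel_right (hδ : DepthBound m k N r δ) (h : n₀ ≤ n) (Θ Λ : Ctx2) :
    Multiset.Rel Occ.Le (occs δ σ n₀ Θ.right Λ.right) (occs δ σ n Θ.join Λ.join) :=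
  have rel b := hδ.rel_map (σ := σ) h b (f := fun a : Fml 0 × ℕ × ℕ => (a.1, a.2.2))
    (g := fun a => (a.1, max a.2.1 a.2.2)) fun _ => ⟨rfl, le_max_right ..⟩
  (rel true Θ).add (rel false Λ)

theorem instDer_cut (hδ : DepthBound m k N r δ) (hn : n ≤ N) (h₀ : n₀ < n) (h₁ : n₁ < n)
    {φ : Fml 0} {i j : ℕ} (hm : φ.complexity + 1 ≤ m)
    (D₀ : InstDer r n₀ (occ δ σ n₀ false (φ, i) ::ₘ occs δ σ n₀ Θ.left Λ.left))
    (D₁ : InstDer r n₁ (occ δ σ n₁ true (φ, j) ::ₘ occs δ σ n₁ Θ.right Λ.right)) :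
    InstDer r n (occs δ σ n Θ.join Λ.join) :=
  .cut (i := max i j) (d := max (δ n₀ φ.complexity) (δ n₁ φ.complexity)) h₀ h₁
    (max_lt (hδ.cut (h₀.trans_le hn) hm) (hδ.cut (h₁.trans_le hn) hm))
    (D₀.raise (Occ.rel_cons (le_max_left ..) (le_max_left ..) (hδ.rel_left h₀.le Θ Λ)))
    (D₁.raise (Occ.rel_cons (le_max_right ..) (le_max_right ..) (hδ.rel_right h₁.le Θ Λ)))

theorem instDer_neg (hδ : DepthBound m k N r δ) (b : Bool) (h₀ : n₀ < n) {φ : Fml 0} {i : ℕ}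
    (D : InstDer r n₀ (occ δ σ n₀ (!b) (φ, i) ::ₘ occs δ σ n₀ Γ Δ)) :
    InstDer r n (occ δ σ n b (.neg φ, i) ::ₘ occs δ σ n Γ Δ) := by
  refine (InstDer.inv (.neg b (φ.subst σ)) i (δ n₀ φ.complexity) h₀ ?_).raise
    (Occ.rel_cons le_rfl (hδ.step h₀ (Nat.lt_succ_self _)) (hδ.rel_occs h₀.le))
  rintro _ rfl
  exact D

theorem instDer_andL (hδ : DepthBound m k N r δ) (h₀ : n₀ < n) {φ ψ : Fml 0} {i j : ℕ}
    (D : InstDer r n₀ (occ δ σ n₀ true (φ, i) ::ₘ occ δ σ n₀ true (ψ, j) ::ₘ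
      occs δ σ n₀ Γ Δ)) :
    InstDer r n (occ δ σ n true (.and φ ψ, max i j) ::ₘ occs δ σ n Γ Δ) := by
  refine (InstDer.inv (.andL (φ.subst σ) (ψ.subst σ)) (max i j)
    (max (δ n₀ φ.complexity) (δ n₀ ψ.complexity)) h₀ ?_).raise (Occ.rel_cons le_rfl
      (max_lt (hδ.step h₀ ?_) (hδ.step h₀ ?_)) (hδ.rel_occs h₀.le))
  · rintro _ rfl
    simp only [Multiset.insert_eq_cons, Multiset.map_cons, Multiset.map_singleton,
      Multiset.cons_add, Multiset.singleton_add]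
    exact D.raise (Occ.rel_cons (le_max_left ..) (le_max_left ..)
      (Occ.rel_cons (le_max_right ..) (le_max_right ..) (Occ.rel_refl _)))
  · exact Nat.lt_succ_of_le (le_max_left ..)
  · exact Nat.lt_succ_of_le (le_max_right ..)

theorem instDer_andR (hδ : DepthBound m k N r δ) (h₀ : n₀ < n) (h₁ : n₁ < n) {φ ψ : Fml 0}
    {i j : ℕ} (D₀ : InstDer r n₀ (occ δ σ n₀ false (φ, i) ::ₘ occs δ σ n₀ Θ.left Λ.left))
    (D₁ : InstDer r n₁ (occ δ σ n₁ false (ψ, j) ::ₘ occs δ σ n₁ Θ.right Λ.right)) :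
    InstDer r n (occ δ σ n false (.and φ ψ, max i j) ::ₘ occs δ σ n Θ.join Λ.join) := by
  refine (InstDer.inv (.andR (φ.subst σ) (ψ.subst σ)) (max i j)
    (max (δ n₀ φ.complexity) (δ n₁ ψ.complexity)) (max_lt h₀ h₁) ?_).raise (Occ.rel_cons le_rfl
      (max_lt (hδ.step h₀ ?_) (hδ.step h₁ ?_)) (Occ.rel_refl _))
  · rintro _ (rfl | rfl)
    · exact (D₀.raise (Occ.rel_cons (le_max_left ..) (le_max_left ..)
        (hδ.rel_left h₀.le Θ Λ))).mono (le_max_left ..)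
    · exact (D₁.raise (Occ.rel_cons (le_max_right ..) (le_max_right ..)
        (hδ.rel_right h₁.le Θ Λ))).mono (le_max_right ..)
  · exact Nat.lt_succ_of_le (le_max_left ..)
  · exact Nat.lt_succ_of_le (le_max_right ..)

theorem instDer_allL (hδ : DepthBound m k N r δ) (h₀ : n₀ < n) {φ : Fml 1} {s : Tm 0} {i j : ℕ}
    (D : InstDer r n₀ (occ δ σ n₀ true (.all φ, i) ::ₘ occ δ σ n₀ true (φ.inst s, j) ::ₘ
      occs δ σ n₀ Γ Δ)) :
    InstDer r n (occ δ σ n true (.all φ, max i j) ::ₘ occs δ σ n Γ Δ) := by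
  rw [Multiset.cons_swap, occ, Fml.subst_inst, Fml.complexity_inst] at D
  have hd : δ n₀ φ.complexity < δ n (Fml.all φ).complexity := hδ.step h₀ (Nat.lt_succ_self _)
  obtain ⟨d, hd'⟩ := Nat.exists_eq_succ_of_ne_zero (Nat.ne_zero_of_lt hd)
  rw [hd'] at hd
  have mem : ⟨true, .all (φ.subst σ), max i j, d + 1⟩ ∈
      occ δ σ n true (.all φ, max i j) ::ₘ occs δ σ n Γ Δ := by
    rw [occ, hd']
    exact Multiset.mem_cons_self ..
  exact .allL (s.subst σ) mem h₀ (D.raise (Occ.rel_cons (le_max_right ..) (Nat.le_of_lt_succ hd)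
    (Occ.rel_cons (le_max_left ..) (hδ.mono _ h₀.le) (hδ.rel_occs h₀.le))))

theorem instDer_allR (hδ : DepthBound m k N r δ) (h₀ : n₀ < n) {φ : Fml 1} {y i : ℕ}
    (hΓ : Γ.Fresh y) (hΔ : Δ.Fresh y) (hφ : y ∉ (Fml.all φ).FV)
    (D : ∀ σ, InstDer r n₀ (occ δ σ n₀ false (φ.inst (.fv y), i) ::ₘ occs δ σ n₀ Γ Δ)) :
    InstDer r n (occ δ σ n false (.all φ, i) ::ₘ occs δ σ n Γ Δ) := by
  refine (InstDer.inv (.allR (φ.subst σ)) i (δ n₀ φ.complexity) h₀ ?_).raise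
    (Occ.rel_cons le_rfl (hδ.step h₀ (Nat.lt_succ_self _)) (hδ.rel_occs h₀.le))
  rintro _ ⟨s, rfl⟩
  have E := D (Function.update σ y s)
  rwa [occs_update hΓ hΔ, occ, Fml.subst_update_inst_fv hφ, Fml.complexity_inst] at E

theorem instDer_tr (hδ : DepthBound m k N r δ) (b : Bool) (h₀ : n₀ < n) {φ : Fml 0} {i : ℕ}
    (hφ : φ.IsSentence) (hk : i + 1 ≤ k)
    (D : InstDer r n₀ (occ δ σ n₀ b (φ, i) ::ₘ occs δ σ n₀ Γ Δ)) :
    InstDer r n (occ δ σ n b (truthOf φ, i + 1) ::ₘ occs δ σ n Γ Δ) := by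
  rw [occ, hφ.subst_eq] at D
  rw [occ, subst_truthOf]
  refine (InstDer.inv (.tr b φ hφ) i (δ n₀ φ.complexity) h₀ ?_).raise
    (Occ.rel_cons le_rfl (hδ.truth _ (Nat.le_of_add_left_le hk) h₀) (hδ.rel_occs h₀.le))
  rintro _ rfl
  exact D

theorem instDer_ax (hδ : DepthBound m k N r δ) (h₀ : n₀ < n) {φ : Fml 0} (hφ : ArithAxiom φ)
    (D : InstDer r n₀ (occ δ σ n₀ true (φ, 0) ::ₘ occs δ σ n₀ Γ Δ)) :
    InstDer r n (occs δ σ n Γ Δ) :=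
  D.arith_of_rel (.ax (hφ.subst σ)) nofun h₀ (hδ.rel_occs h₀.le)

theorem instDer_eq2 (hδ : DepthBound m k N r δ) (h₀ : n₀ < n) {s t : Tm 0} {a b : Tm 1}
    (D : InstDer r n₀ (occ δ σ n₀ true (.eq s t, 0) ::ₘ
      occ δ σ n₀ true (.eq (Tm.inst s a) (Tm.inst s b), 0) ::ₘ
      occ δ σ n₀ true (.eq (Tm.inst t a) (Tm.inst t b), 0) ::ₘ occs δ σ n₀ Γ Δ)) :
    InstDer r n (occ δ σ n true (.eq s t, 0) ::ₘ
      occ δ σ n true (.eq (Tm.inst t a) (Tm.inst t b), 0) ::ₘ occs δ σ n Γ Δ) := by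
  simp only [occ, Fml.subst, Tm.subst_inst] at D ⊢
  rw [Multiset.cons_swap] at D
  refine D.arith_of_rel (.eq2 _ (t.subst σ) _ _) ?_ h₀ (Occ.rel_cons_isEquation (by trivial)
    (Occ.rel_cons_isEquation (by trivial) (hδ.rel_occs h₀.le)))
  rintro _ (rfl | rfl)
  · exact ⟨_, _, Multiset.mem_cons_self ..⟩
  · exact ⟨_, _, Multiset.mem_cons_of_mem (Multiset.mem_cons_self ..)⟩

theorem instDer_q2 (hδ : DepthBound m k N r δ) (h₀ : n₀ < n) {s t : Tm 0}
    (D : InstDer r n₀ (occ δ σ n₀ true (.eq s t, 0) ::ₘ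
      occ δ σ n₀ true (.eq (.succ s) (.succ t), 0) ::ₘ occs δ σ n₀ Γ Δ)) :
    InstDer r n (occ δ σ n true (.eq (.succ s) (.succ t), 0) ::ₘ occs δ σ n Γ Δ) := by
  refine D.arith_of_rel (.q2 ..) ?_ h₀ (Occ.rel_cons_isEquation (by trivial) (hδ.rel_occs h₀.le))
  rintro _ rfl
  exact ⟨_, _, Multiset.mem_cons_self ..⟩

theorem instDer_q3 (hδ : DepthBound m k N r δ) (h₀ : n₀ < n) (h₁ : n₁ < n) {s : Tm 0} {y : ℕ}
    (hΘ : Θ.join.Fresh y) (hΛ : Λ.join.Fresh y) (hs : y ∉ s.FV)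
    (D₀ : InstDer r n₀ (occ δ σ n₀ true (.eq s .zero, 0) ::ₘ occs δ σ n₀ Θ.left Λ.left))
    (D₁ : ∀ σ, InstDer r n₁ (occ δ σ n₁ true (.eq s (.succ (.fv y)), 0) ::ₘ
      occs δ σ n₁ Θ.right Λ.right)) :
    InstDer r n (occs δ σ n Θ.join Λ.join) := by
  refine .arith (.q3 (s.subst σ)) nofun (fun _ _ => max_lt h₀ h₁) ?_
  rintro _ (rfl | ⟨u, rfl⟩)
  · exact (D₀.raise (Occ.rel_cons_isEquation (by trivial) (hδ.rel_left h₀.le Θ Λ))).mono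
      (le_max_left ..)
  · have E := D₁ (Function.update σ y u)
    rw [occs_update (Ctx2.fresh_right hΘ) (Ctx2.fresh_right hΛ), occ, Fml.subst,
      Tm.subst_update hs, Tm.subst, Tm.subst, Tm.lift_eq_self, Function.update_self] at E
    exact (E.raise (Occ.rel_cons_isEquation (by trivial) (hδ.rel_right h₁.le Θ Λ))).mono
      (le_max_right ..)

end DepthBound

theorem Der.toInstDer (hδ : DepthBound m k N r δ) (D : Der m k n Γ Δ) (hn : n ≤ N) :
    InstDer r n (occs δ σ n Γ Δ) := by
  induction D generalizing σ with simp only [occs_cons_left, occs_cons_right] at *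
  | ref =>
    exact .ref (Multiset.mem_cons_of_mem (Multiset.mem_cons_self ..)) (Multiset.mem_cons_self ..)
  | cut _ _ _ _ _ h₀ h₁ hm _ _ ih₀ ih₁ =>
    exact hδ.instDer_cut hn h₀ h₁ hm (ih₀ (h₀.le.trans hn)) (ih₁ (h₁.le.trans hn))
  | negL _ _ _ _ h₀ _ ih => exact hδ.instDer_neg true h₀ (ih (h₀.le.trans hn))
  | negR _ _ _ _ h₀ _ ih => exact hδ.instDer_neg false h₀ (ih (h₀.le.trans hn))
  | andL _ _ _ _ _ _ h₀ _ ih => exact hδ.instDer_andL h₀ (ih (h₀.le.trans hn))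
  | andR _ _ _ _ _ _ h₀ h₁ _ _ ih₀ ih₁ =>
    exact hδ.instDer_andR h₀ h₁ (ih₀ (h₀.le.trans hn)) (ih₁ (h₁.le.trans hn))
  | allL _ _ _ _ _ _ h₀ _ ih => exact hδ.instDer_allL h₀ (ih (h₀.le.trans hn))
  | allR _ _ _ _ _ h₀ hΓ hΔ hφ _ ih =>
    exact hδ.instDer_allR h₀ hΓ hΔ hφ fun _ => ih (h₀.le.trans hn)
  | eq1 _ _ _ h₀ _ ih => exact hδ.instDer_ax h₀ (.eq1 _) (ih (h₀.le.trans hn))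
  | eq2 _ _ _ _ _ _ h₀ _ ih => exact hδ.instDer_eq2 h₀ (ih (h₀.le.trans hn))
  | q1 _ _ _ s =>
    refine .arith (n₀ := 0) (.q1 (s.subst σ)) ?_ nofun nofun
    rintro _ rfl
    exact ⟨_, _, Multiset.mem_cons_self ..⟩
  | q2 _ _ _ _ h₀ _ ih => exact hδ.instDer_q2 h₀ (ih (h₀.le.trans hn))
  | q3 _ _ _ _ h₀ h₁ hΓ hΔ hs _ _ ih₀ ih₁ =>
    exact hδ.instDer_q3 h₀ h₁ hΓ hΔ hs (ih₀ (h₀.le.trans hn)) fun _ => ih₁ (h₁.le.trans hn)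
  | q4 _ _ _ h₀ _ ih => exact hδ.instDer_ax h₀ (.q4 _) (ih (h₀.le.trans hn))
  | q5 _ _ _ _ h₀ _ ih => exact hδ.instDer_ax h₀ (.q5 _ _) (ih (h₀.le.trans hn))
  | q6 _ _ _ h₀ _ ih => exact hδ.instDer_ax h₀ (.q6 _) (ih (h₀.le.trans hn))
  | q7 _ _ _ _ h₀ _ ih => exact hδ.instDer_ax h₀ (.q7 _ _) (ih (h₀.le.trans hn))
  | trR _ _ _ _ h₀ hφ hk _ ih => exact hδ.instDer_tr false h₀ hφ hk (ih (h₀.le.trans hn))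
  | trL _ _ _ _ h₀ hφ hk _ ih => exact hδ.instDer_tr true h₀ hφ hk (ih (h₀.le.trans hn))

theorem Ctx2.join_tc_le (h₀ : ∀ a ∈ Θ.left, a.2 ≤ k) (h₁ : ∀ a ∈ Θ.right, a.2 ≤ k) :
    ∀ a ∈ Θ.join, a.2 ≤ k := by
  rw [Ctx2.left, Multiset.forall_mem_map_iff] at h₀
  rw [Ctx2.right, Multiset.forall_mem_map_iff] at h₁
  rw [Ctx2.join, Multiset.forall_mem_map_iff]
  exact fun a ha => max_le (h₀ a ha) (h₁ a ha)

theorem Der.tc_le (D : Der m k n Γ Δ) : (∀ a ∈ Γ, a.2 ≤ k) ∧ ∀ a ∈ Δ, a.2 ≤ k := by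
  induction D <;> simp only [Multiset.forall_mem_cons, Multiset.forall_mem_map_iff] at *
  case cut ih₀ ih₁ =>
    exact ⟨Ctx2.join_tc_le ih₀.1 ih₁.1.2, Ctx2.join_tc_le ih₀.2.2 ih₁.2⟩
  case andR ih₀ ih₁ =>
    exact ⟨Ctx2.join_tc_le ih₀.1 ih₁.1, max_le ih₀.2.1 ih₁.2.1, Ctx2.join_tc_le ih₀.2.2 ih₁.2.2⟩
  case q3 ih₀ ih₁ =>
    exact ⟨Ctx2.join_tc_le ih₀.1.2 ih₁.1.2, Ctx2.join_tc_le ih₀.2 ih₁.2⟩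
  all_goals
    try simp only [max_le_iff, Nat.zero_le, implies_true, true_and] at *
  all_goals tauto

end

/-! ### Back to eigenvariables -/

/-- The formula `x` with its truth complexity respects the bounds of the occurrence `a`, and is an
equation only with truth complexity `0`. -/
def Below (x : Fml 0 × ℕ) (a : Occ) : Prop :=
  x.1 = a.fml ∧ x.2 ≤ a.tc ∧ (x.1.IsEquation → x.2 = 0)

/-- The sequent `Γ ⇒ Δ` with its truth complexities respects the bounds of the signed sequent
`G`. -/
def Realizes (Γ Δ : Ctx) (G : Multiset Occ) : Prop :=
  Multiset.Rel Below Γ (G.filter fun a => a.side = true) ∧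
    Multiset.Rel Below Δ (G.filter fun a => a.side = false)

/-- Some sequent that respects the bounds of `G` has a cut-free derivation of length at most `n`. -/
def Realizable (k n : ℕ) (G : Multiset Occ) : Prop :=
  ∃ Γ Δ : Ctx, Realizes Γ Δ G ∧ Der 0 k n Γ Δ

theorem Below.exists_join {Γ Δ : Ctx} {G : Multiset Occ} (h₀ : Multiset.Rel Below Γ G)
    (h₁ : Multiset.Rel Below Δ G) :
    ∃ Θ : Ctx2, Θ.left = Γ ∧ Θ.right = Δ ∧ Multiset.Rel Below Θ.join G := by
  induction G using Multiset.induction generalizing Γ Δ with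
  | empty =>
    obtain rfl := Multiset.rel_zero_right.1 h₀
    obtain rfl := Multiset.rel_zero_right.1 h₁
    exact ⟨0, rfl, rfl, .zero⟩
  | cons a G ih =>
    obtain ⟨⟨φ, i⟩, Γ, ⟨hφ, hi, hi'⟩, h₀', rfl⟩ := Multiset.rel_cons_right.1 h₀
    obtain ⟨⟨ψ, j⟩, Δ, ⟨hψ, hj, hj'⟩, h₁', rfl⟩ := Multiset.rel_cons_right.1 h₁
    obtain rfl : φ = ψ := hφ.trans hψ.symm
    obtain ⟨Θ, rfl, rfl, hΘ⟩ := ih h₀' h₁'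
    refine ⟨(φ, i, j) ::ₘ Θ, Multiset.map_cons .., Multiset.map_cons .., ?_⟩
    rw [Ctx2.join, Multiset.map_cons]
    exact .cons ⟨hφ, max_le hi hj, fun h => Nat.max_eq_zero_iff.2 ⟨hi' h, hj' h⟩⟩ hΘ

theorem Below.forget_eq {Γ : Ctx} {G : Multiset Occ} (h : Multiset.Rel Below Γ G) :
    Γ.forget = G.map Occ.fml := by
  rw [Ctx.forget, ← Multiset.rel_eq, Multiset.rel_map]
  exact h.mono fun _ _ _ _ h => h.1

section

variable {k n n₀ : ℕ} {Γ Δ : Ctx} {G : Multiset Occ} {φ ψ : Fml 0} {s t : Tm 0} {i d d' : ℕ}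

namespace Realizes

theorem cons_left {j : ℕ} (h : Realizes Γ Δ G) (hj : j ≤ i) (hφ : φ.IsEquation → j = 0) :
    Realizes ((φ, j) ::ₘ Γ) Δ (⟨true, φ, i, d⟩ ::ₘ G) := by
  refine ⟨?_, by simpa using h.2⟩
  rw [Multiset.filter_cons_of_pos (p := fun a : Occ => a.side = true) _ rfl]
  exact .cons ⟨rfl, hj, hφ⟩ h.1

theorem cons_right {j : ℕ} (h : Realizes Γ Δ G) (hj : j ≤ i) (hφ : φ.IsEquation → j = 0) :
    Realizes Γ ((φ, j) ::ₘ Δ) (⟨false, φ, i, d⟩ ::ₘ G) := by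
  refine ⟨by simpa using h.1, ?_⟩
  rw [Multiset.filter_cons_of_pos (p := fun a : Occ => a.side = false) _ rfl]
  exact .cons ⟨rfl, hj, hφ⟩ h.2

theorem cons_eq (h : Realizes Γ Δ G) :
    Realizes ((.eq s t, 0) ::ₘ Γ) Δ (⟨true, .eq s t, i, d⟩ ::ₘ G) :=
  h.cons_left (Nat.zero_le _) fun _ => rfl

theorem of_cons_left (h : Realizes Γ Δ (⟨true, φ, i, d⟩ ::ₘ G)) :
    ∃ j Γ', Γ = (φ, j) ::ₘ Γ' ∧ j ≤ i ∧ (φ.IsEquation → j = 0) ∧ Realizes Γ' Δ G := by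
  obtain ⟨hΓ, hΔ⟩ := h
  rw [Multiset.filter_cons_of_pos (p := fun a : Occ => a.side = true) _ rfl] at hΓ
  obtain ⟨⟨ψ, j⟩, Γ', ⟨hψ, hj, hj'⟩, hΓ', rfl⟩ := Multiset.rel_cons_right.1 hΓ
  obtain rfl : ψ = φ := hψ
  exact ⟨j, Γ', rfl, hj, hj', hΓ', by simpa using hΔ⟩

theorem of_cons_right (h : Realizes Γ Δ (⟨false, φ, i, d⟩ ::ₘ G)) :
    ∃ j Δ', Δ = (φ, j) ::ₘ Δ' ∧ j ≤ i ∧ Realizes Γ Δ' G := by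
  obtain ⟨hΓ, hΔ⟩ := h
  rw [Multiset.filter_cons_of_pos (p := fun a : Occ => a.side = false) _ rfl] at hΔ
  obtain ⟨⟨ψ, j⟩, Δ', ⟨hψ, hj, -⟩, hΔ', rfl⟩ := Multiset.rel_cons_right.1 hΔ
  obtain rfl : ψ = φ := hψ
  exact ⟨j, Δ', rfl, hj, by simpa using hΓ, hΔ'⟩

theorem of_cons_eq (h : Realizes Γ Δ (⟨true, .eq s t, i, d⟩ ::ₘ G)) :
    ∃ Γ', Γ = (.eq s t, 0) ::ₘ Γ' ∧ Realizes Γ' Δ G := by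
  obtain ⟨j, Γ', rfl, -, hj, h'⟩ := h.of_cons_left
  obtain rfl := hj trivial
  exact ⟨Γ', rfl, h'⟩

theorem exists_join {Γ₀ Δ₀ Γ₁ Δ₁ : Ctx} (h₀ : Realizes Γ₀ Δ₀ G) (h₁ : Realizes Γ₁ Δ₁ G) :
    ∃ Θ Λ : Ctx2, Θ.left = Γ₀ ∧ Θ.right = Γ₁ ∧ Λ.left = Δ₀ ∧ Λ.right = Δ₁ ∧
      Realizes Θ.join Λ.join G := by
  obtain ⟨Θ, hΘ₀, hΘ₁, hΘ⟩ := Below.exists_join h₀.1 h₁.1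
  obtain ⟨Λ, hΛ₀, hΛ₁, hΛ⟩ := Below.exists_join h₀.2 h₁.2
  exact ⟨Θ, Λ, hΘ₀, hΘ₁, hΛ₀, hΛ₁, hΘ, hΛ⟩

theorem exists_fml_eq {a : Fml 0 × ℕ} (h : Realizes Γ Δ G) (ha : a ∈ Γ ∨ a ∈ Δ) :
    ∃ b ∈ G, a.1 = b.fml := by
  rcases ha with ha | ha
  · obtain ⟨b, hb, hab⟩ := Multiset.exists_mem_of_rel_of_mem h.1 ha
    exact ⟨b, Multiset.mem_of_mem_filter hb, hab.1⟩
  · obtain ⟨b, hb, hab⟩ := Multiset.exists_mem_of_rel_of_mem h.2 ha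
    exact ⟨b, Multiset.mem_of_mem_filter hb, hab.1⟩

end Realizes

theorem exists_realizes_zero (G : Multiset Occ) :
    ∃ Γ Δ : Multiset (Fml 0), Realizes (Γ.map fun φ => (φ, 0)) (Δ.map fun φ => (φ, 0)) G := by
  refine ⟨(G.filter fun a => a.side = true).map Occ.fml,
    (G.filter fun a => a.side = false).map Occ.fml, ?_, ?_⟩ <;>
  · rw [Multiset.map_map, Multiset.rel_map_left]
    exact Multiset.rel_refl_of_refl_on fun a _ => ⟨rfl, Nat.zero_le _, fun _ => rfl⟩

theorem exists_fresh (G : Multiset Occ) (F : Finset ℕ) :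
    ∃ y, y ∉ F ∧ ∀ Γ Δ : Ctx, Realizes Γ Δ G → Γ.Fresh y ∧ Δ.Fresh y := by
  classical
  obtain ⟨y, hy⟩ := Infinite.exists_notMem_finset (F ∪ (G.toFinset.biUnion fun a => a.fml.FV))
  simp only [Finset.mem_union, Finset.mem_biUnion, Multiset.mem_toFinset, not_or, not_exists,
    not_and] at hy
  have notMem : ∀ {Γ Δ a}, Realizes Γ Δ G → a ∈ Γ ∨ a ∈ Δ → y ∉ a.1.FV := by
    intro Γ Δ a h ha
    obtain ⟨b, hb, hab⟩ := h.exists_fml_eq ha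
    exact hab ▸ hy.2 b hb
  exact ⟨y, hy.1, fun Γ Δ h =>
    ⟨fun a ha => notMem h (.inl ha), fun a ha => notMem h (.inr ha)⟩⟩

namespace Realizable

theorem of_cons_left (h : Realizable k n (⟨true, φ, i, d⟩ ::ₘ G)) :
    ∃ j Γ Δ, j ≤ i ∧ Realizes Γ Δ G ∧ Der 0 k n ((φ, j) ::ₘ Γ) Δ := by
  obtain ⟨Γ, Δ, h, D⟩ := h
  obtain ⟨j, Γ, rfl, hj, -, h⟩ := h.of_cons_left
  exact ⟨j, Γ, Δ, hj, h, D⟩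

theorem of_cons_right (h : Realizable k n (⟨false, φ, i, d⟩ ::ₘ G)) :
    ∃ j Γ Δ, j ≤ i ∧ Realizes Γ Δ G ∧ Der 0 k n Γ ((φ, j) ::ₘ Δ) := by
  obtain ⟨Γ, Δ, h, D⟩ := h
  obtain ⟨j, Δ, rfl, hj, h⟩ := h.of_cons_right
  exact ⟨j, Γ, Δ, hj, h, D⟩

theorem of_cons_eq (h : Realizable k n (⟨true, .eq s t, i, d⟩ ::ₘ G)) :
    ∃ Γ Δ, Realizes Γ Δ G ∧ Der 0 k n ((.eq s t, 0) ::ₘ Γ) Δ := by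
  obtain ⟨Γ, Δ, h, D⟩ := h
  obtain ⟨Γ', rfl, h'⟩ := h.of_cons_eq
  exact ⟨Γ', Δ, h', D⟩

theorem negL (h₀ : n₀ < n) (h : Realizable k n₀ (⟨false, φ, i, d⟩ ::ₘ G)) :
    Realizable k n (⟨true, .neg φ, i, d'⟩ ::ₘ G) := by
  obtain ⟨j, Γ, Δ, hj, h, D⟩ := h.of_cons_right
  exact ⟨_, _, h.cons_left hj nofun, .negL _ _ _ _ h₀ D⟩

theorem negR (h₀ : n₀ < n) (h : Realizable k n₀ (⟨true, φ, i, d⟩ ::ₘ G)) :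
    Realizable k n (⟨false, .neg φ, i, d'⟩ ::ₘ G) := by
  obtain ⟨j, Γ, Δ, hj, h, D⟩ := h.of_cons_left
  exact ⟨_, _, h.cons_right hj nofun, .negR _ _ _ _ h₀ D⟩

theorem andL (h₀ : n₀ < n)
    (h : Realizable k n₀ (⟨true, φ, i, d⟩ ::ₘ ⟨true, ψ, i, d⟩ ::ₘ G)) :
    Realizable k n (⟨true, .and φ ψ, i, d'⟩ ::ₘ G) := by
  obtain ⟨j, Γ, Δ, hj, h, D⟩ := h.of_cons_left
  obtain ⟨j', Γ, rfl, hj', -, h⟩ := h.of_cons_left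
  exact ⟨_, _, h.cons_left (max_le hj hj') nofun, .andL _ _ _ _ _ _ h₀ D⟩

theorem andR (h₀ : n₀ < n) (hφ : Realizable k n₀ (⟨false, φ, i, d⟩ ::ₘ G))
    (hψ : Realizable k n₀ (⟨false, ψ, i, d⟩ ::ₘ G)) :
    Realizable k n (⟨false, .and φ ψ, i, d'⟩ ::ₘ G) := by
  obtain ⟨j₀, Γ₀, Δ₀, hj₀, hφ, D₀⟩ := hφ.of_cons_right
  obtain ⟨j₁, Γ₁, Δ₁, hj₁, hψ, D₁⟩ := hψ.of_cons_right
  obtain ⟨Θ, Λ, rfl, rfl, rfl, rfl, h⟩ := hφ.exists_join hψ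
  exact ⟨_, _, h.cons_right (max_le hj₀ hj₁) nofun, .andR _ _ _ _ _ _ h₀ h₀ D₀ D₁⟩

theorem allL {φ : Fml 1} (h₀ : n₀ < n)
    (h : Realizable k n₀ (⟨true, φ.inst s, i, d⟩ ::ₘ ⟨true, .all φ, i, d'⟩ ::ₘ G)) :
    Realizable k n (⟨true, .all φ, i, d'⟩ ::ₘ G) := by
  obtain ⟨j, Γ, Δ, hj, h, D⟩ := h.of_cons_left
  obtain ⟨j', Γ, rfl, hj', -, h⟩ := h.of_cons_left
  rw [Multiset.cons_swap] at D
  exact ⟨_, _, h.cons_left (max_le hj' hj) nofun, .allL _ _ _ _ _ _ h₀ D⟩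

theorem allR {φ : Fml 1} (h₀ : n₀ < n)
    (h : ∀ s, Realizable k n₀ (⟨false, φ.inst s, i, d⟩ ::ₘ G)) :
    Realizable k n (⟨false, .all φ, i, d'⟩ ::ₘ G) := by
  obtain ⟨y, hy, fresh⟩ := exists_fresh G φ.FV
  obtain ⟨j, Γ, Δ, hj, h, D⟩ := (h (.fv y)).of_cons_right
  exact ⟨_, _, h.cons_right hj nofun,
    .allR _ _ _ y _ h₀ (fresh _ _ h).1 (fresh _ _ h).2 hy D⟩

theorem trL (h₀ : n₀ < n) (hφ : φ.IsSentence) (hk : i + 1 ≤ k)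
    (h : Realizable k n₀ (⟨true, φ, i, d⟩ ::ₘ G)) :
    Realizable k n (⟨true, truthOf φ, i + 1, d'⟩ ::ₘ G) := by
  obtain ⟨j, Γ, Δ, hj, h, D⟩ := h.of_cons_left
  exact ⟨_, _, h.cons_left (Nat.succ_le_succ hj) nofun,
    .trL _ _ _ _ h₀ hφ ((Nat.succ_le_succ hj).trans hk) D⟩

theorem trR (h₀ : n₀ < n) (hφ : φ.IsSentence) (hk : i + 1 ≤ k)
    (h : Realizable k n₀ (⟨false, φ, i, d⟩ ::ₘ G)) :
    Realizable k n (⟨false, truthOf φ, i + 1, d'⟩ ::ₘ G) := by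
  obtain ⟨j, Γ, Δ, hj, h, D⟩ := h.of_cons_right
  exact ⟨_, _, h.cons_right (Nat.succ_le_succ hj) nofun,
    .trR _ _ _ _ h₀ hφ ((Nat.succ_le_succ hj).trans hk) D⟩

theorem decomp {b : Bool} {τ : ℕ} {J : Set (Multiset (Bool × Fml 0))} (hJ : Decomp b φ τ J)
    (hk : i + τ ≤ k) (h₀ : n₀ < n) (h : ∀ A ∈ J, Realizable k n₀ (A.map (withBounds i d) + G)) :
    Realizable k n (⟨b, φ, i + τ, d'⟩ ::ₘ G) := by
  cases hJ with
  | neg b φ =>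
    cases b with
    | true => exact negL h₀ (h _ rfl)
    | false => exact negR h₀ (h _ rfl)
  | andL φ ψ =>
    have h := h _ rfl
    rw [Multiset.insert_eq_cons, Multiset.map_cons, Multiset.cons_add] at h
    exact andL h₀ h
  | andR φ ψ => exact andR h₀ (h _ (.inl rfl)) (h _ (.inr rfl))
  | allR φ => exact allR h₀ fun s => h _ ⟨s, rfl⟩
  | tr b φ hφ =>
    cases b with
    | true => exact trL h₀ hφ hk (h _ rfl)
    | false => exact trR h₀ hφ hk (h _ rfl)

theorem ref {i' : ℕ} (hL : ⟨true, .eq s t, i, d⟩ ∈ G) (hR : ⟨false, .eq s t, i', d'⟩ ∈ G) :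
    Realizable k n G := by
  obtain ⟨G, rfl⟩ := Multiset.exists_cons_of_mem hL
  obtain ⟨G, rfl⟩ := Multiset.exists_cons_of_mem ((Multiset.mem_cons.1 hR).resolve_left nofun)
  obtain ⟨Γ, Δ, h⟩ := exists_realizes_zero G
  exact ⟨_, _, (h.cons_right (Nat.zero_le _) fun _ => rfl).cons_eq, .ref ..⟩

theorem ax (hφ : ArithAxiom φ) (h₀ : n₀ < n) (h : Realizable k n₀ (⟨true, φ, i, d⟩ ::ₘ G)) :
    Realizable k n G := by
  cases hφ with (obtain ⟨Γ, Δ, h, D⟩ := h.of_cons_eq; refine ⟨Γ, Δ, h, ?_⟩)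
  | eq1 => exact .eq1 _ _ _ h₀ D
  | q4 => exact .q4 _ _ _ h₀ D
  | q5 => exact .q5 _ _ _ _ h₀ D
  | q6 => exact .q6 _ _ _ h₀ D
  | q7 => exact .q7 _ _ _ _ h₀ D

theorem eq2 {a b : Tm 1} {i₀ d₀ i₁ d₁ : ℕ} (h₀ : n₀ < n)
    (h : Realizable k n₀ (⟨true, .eq (Tm.inst s a) (Tm.inst s b), i₀, d₀⟩ ::ₘ
      ⟨true, .eq s t, i, d⟩ ::ₘ ⟨true, .eq (Tm.inst t a) (Tm.inst t b), i₁, d₁⟩ ::ₘ G)) :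
    Realizable k n (⟨true, .eq s t, i, d⟩ ::ₘ
      ⟨true, .eq (Tm.inst t a) (Tm.inst t b), i₁, d₁⟩ ::ₘ G) := by
  obtain ⟨Γ, Δ, hΓ, D⟩ := h.of_cons_eq
  obtain ⟨Γ', rfl, hΓ'⟩ := hΓ.of_cons_eq
  obtain ⟨Γ'', rfl, hΓ''⟩ := hΓ'.of_cons_eq
  rw [Multiset.cons_swap] at D
  exact ⟨_, _, hΓ''.cons_eq.cons_eq, .eq2 _ _ _ _ _ _ h₀ D⟩

/-- If the two principal equations of the replacement rule are one occurrence, then the missing copy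
of `s = t` is itself obtained by replacement, from `t = t`. -/
theorem eq2_collapsed {a b : Tm 1} {i₀ d₀ i₁ d₁ i₂ d₂ : ℕ} (h₀ : n₀ + 3 ≤ n)
    (hst : Fml.eq s t = .eq (Tm.inst t a) (Tm.inst t b))
    (h : Realizable k n₀ (⟨true, .eq (Tm.inst s a) (Tm.inst s b), i₀, d₀⟩ ::ₘ
      ⟨true, .eq s t, i₁, d₁⟩ ::ₘ ⟨true, .eq t t, i₂, d₂⟩ ::ₘ ⟨true, .eq s t, i, d⟩ ::ₘ G)) :
    Realizable k n (⟨true, .eq s t, i, d⟩ ::ₘ G) := by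
  have replaced : Realizable k (n₀ + 1) (⟨true, .eq s t, i₁, d₁⟩ ::ₘ ⟨true, .eq s t, i, d⟩ ::ₘ
      ⟨true, .eq t t, i₂, d₂⟩ ::ₘ G) := by
    rw [Multiset.cons_swap (⟨true, .eq t t, i₂, d₂⟩ : Occ)] at h
    have E := @eq2 k _ n₀ (⟨true, .eq t t, i₂, d₂⟩ ::ₘ G) s t i₁ d₁ a b i₀ d₀ i d
      n₀.lt_succ_self
    rw [← hst] at E
    exact E h
  have contracted : Realizable k (n₀ + 2)
      (⟨true, .eq s t, i, d⟩ ::ₘ ⟨true, .eq t t, i₂, d₂⟩ ::ₘ G) := by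
    have inst (u : Tm 0) : Fml.eq (Tm.inst u (.bv 0)) (Tm.inst u (Tm.lift t)) = .eq u t := by
      rw [Tm.inst_lift, Tm.inst, Fin.cases_zero, Tm.lift_eq_self, Tm.lift_eq_self]
    simpa only [inst] using eq2 (a := .bv 0) (b := Tm.lift t) (n₀ + 1).lt_succ_self
      (by simpa only [inst] using replaced)
  rw [Multiset.cons_swap] at contracted
  exact contracted.ax (.eq1 t) (by omega)

theorem q1 (hG : ⟨true, .eq (.succ s) .zero, i, d⟩ ∈ G) : Realizable k n G := by
  obtain ⟨G, rfl⟩ := Multiset.exists_cons_of_mem hG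
  obtain ⟨Γ, Δ, h⟩ := exists_realizes_zero G
  exact ⟨_, _, h.cons_eq, .q1 ..⟩

theorem q2 {i₀ d₀ : ℕ} (h₀ : n₀ < n) (h : Realizable k n₀ (⟨true, .eq s t, i₀, d₀⟩ ::ₘ
      ⟨true, .eq (.succ s) (.succ t), i, d⟩ ::ₘ G)) :
    Realizable k n (⟨true, .eq (.succ s) (.succ t), i, d⟩ ::ₘ G) := by
  obtain ⟨Γ, Δ, hΓ, D⟩ := h.of_cons_eq
  obtain ⟨Γ', rfl, hΓ'⟩ := hΓ.of_cons_eq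
  exact ⟨_, _, hΓ'.cons_eq, .q2 _ _ _ _ h₀ D⟩

theorem q3 (h₀ : n₀ < n) (hzero : Realizable k n₀ (⟨true, .eq s .zero, i, d⟩ ::ₘ G))
    (hsucc : ∀ u, Realizable k n₀ (⟨true, .eq s (.succ u), i, d⟩ ::ₘ G)) : Realizable k n G := by
  obtain ⟨y, hy, fresh⟩ := exists_fresh G s.FV
  obtain ⟨Γ₀, Δ₀, hzero, D₀⟩ := hzero.of_cons_eq
  obtain ⟨Γ₁, Δ₁, hsucc, D₁⟩ := (hsucc (.fv y)).of_cons_eq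
  obtain ⟨Θ, Λ, rfl, rfl, rfl, rfl, h⟩ := hzero.exists_join hsucc
  exact ⟨_, _, h, .q3 _ _ _ y h₀ h₀ (fresh _ _ h).1 (fresh _ _ h).2 hy D₀ D₁⟩

theorem arith {P J : Set (Fml 0)} (hPJ : ArithRule P J) (hP : ∀ e ∈ P, ∃ i d, ⟨true, e, i, d⟩ ∈ G)
    (h₀ : ∀ e ∈ J, n₀ + 3 ≤ n)
    (h : ∀ e ∈ J, ∀ H, (∀ a ∈ H, a.tc = 0) → Realizable k n₀ (⟨true, e, 0, 0⟩ ::ₘ (H + G))) :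
    Realizable k n G := by
  have lt : ∀ e ∈ J, n₀ < n := fun e he => (Nat.lt_add_of_pos_right three_pos).trans_le (h₀ e he)
  have premiss : ∀ e ∈ J, Realizable k n₀ (⟨true, e, 0, 0⟩ ::ₘ G) := fun e he => by
    simpa only [zero_add] using h e he 0 (fun _ h => absurd h (Multiset.notMem_zero _))
  cases hPJ with
  | ax hφ => exact ax hφ (lt _ rfl) (premiss _ rfl)
  | eq2 s t a b =>
    obtain ⟨i, d, hst⟩ := hP _ (.inl rfl)
    obtain ⟨i', d', hab⟩ := hP _ (.inr rfl)
    obtain ⟨G, rfl⟩ := Multiset.exists_cons_of_mem hst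
    rcases Multiset.mem_cons.1 hab with hab | hab
    · have E := h _ rfl {⟨true, .eq s t, 0, 0⟩, ⟨true, .eq t t, 0, 0⟩} (by simp)
      rw [Multiset.insert_eq_cons, Multiset.cons_add, Multiset.singleton_add] at E
      exact eq2_collapsed (h₀ _ rfl) (congrArg Occ.fml hab).symm E
    · obtain ⟨G, rfl⟩ := Multiset.exists_cons_of_mem hab
      exact eq2 (lt _ rfl) (premiss _ rfl)
  | q1 s =>
    obtain ⟨i, d, hG⟩ := hP _ rfl
    exact q1 hG
  | q2 s t =>
    obtain ⟨i, d, hG⟩ := hP _ rfl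
    obtain ⟨G, rfl⟩ := Multiset.exists_cons_of_mem hG
    exact q2 (lt _ rfl) (premiss _ rfl)
  | q3 s => exact q3 (lt _ (.inl rfl)) (premiss _ (.inl rfl)) fun u => premiss _ (.inr ⟨u, rfl⟩)

end Realizable

theorem InstDer.realizable (D : InstDer 0 n G) (hk : ∀ a ∈ G, a.tc ≤ k) :
    Realizable k (3 * n) G := by
  induction n using Nat.strong_induction_on generalizing G with
  | _ n ih =>
  cases D with
  | ref hL hR => exact .ref hL hR
  | @arith _ n₀ _ P J hPJ hP h₀ D =>
    refine .arith hPJ hP (fun e he => Nat.mul_le_mul_left 3 (h₀ e he)) fun e he H hH => ?_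
    refine ih n₀ (h₀ e he)
      ((D e he).weaken (Multiset.cons_le_cons _ (Multiset.le_add_left ..))) fun a ha => ?_
    obtain rfl | ha := Multiset.mem_cons.1 ha
    · exact Nat.zero_le _
    · exact (Multiset.mem_add.1 ha).elim (fun ha => (hH a ha).trans_le (Nat.zero_le _)) (hk a)
  | @allL _ n₀ _ φ i d s hG h₀ D =>
    have hi : i ≤ k := hk _ hG
    have E := ih n₀ h₀ D (Multiset.forall_mem_cons.2 ⟨hi, hk⟩)
    obtain ⟨G, rfl⟩ := Multiset.exists_cons_of_mem hG
    exact .allL (by omega) E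
  | @inv _ n₀ G b φ τ J hJ i d h₀ D =>
    obtain ⟨hi, hk⟩ := Multiset.forall_mem_cons.1 hk
    refine .decomp hJ hi (Nat.mul_lt_mul_of_pos_left h₀ three_pos) fun A hA =>
      ih n₀ h₀ (D A hA) fun a ha => ?_
    rcases Multiset.mem_add.1 ha with ha | ha
    · obtain ⟨x, -, rfl⟩ := Multiset.mem_map.1 ha
      exact Nat.le_of_add_right_le hi
    · exact hk a ha
  | cut h₀ h₁ hd D₀ D₁ => exact absurd hd (Nat.not_lt_zero _)

end

theorem forget_eq_filter_occs (δ : ℕ → ℕ → ℕ) (n : ℕ) (Γ Δ : Ctx) :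
    ((occs δ Tm.fv n Γ Δ).filter fun a => a.side = true).map Occ.fml = Γ.forget ∧
      ((occs δ Tm.fv n Γ Δ).filter fun a => a.side = false).map Occ.fml = Δ.forget := by
  constructor <;>
    simp [occs, occ, Multiset.filter_add, Multiset.filter_map, Multiset.map_map, Ctx.forget,
      Fml.subst_fv]

theorem DepthBound.provable {m k n r : ℕ} {δ : ℕ → ℕ → ℕ} {Γ Δ : Multiset (Fml 0)}
    (hδ : DepthBound m k n r δ) (h : Provable n m k Γ Δ) :
    Provable (3 * hyperexp n r) 0 k Γ Δ := by
  obtain ⟨Γ, Δ, rfl, rfl, D⟩ := h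
  have tc_le : ∀ a ∈ occs δ Tm.fv n Γ Δ, a.tc ≤ k := by
    intro a ha
    rw [occs, Multiset.mem_add, Multiset.mem_map, Multiset.mem_map] at ha
    rcases ha with ⟨x, hx, rfl⟩ | ⟨x, hx, rfl⟩
    exacts [D.tc_le.1 x hx, D.tc_le.2 x hx]
  obtain ⟨Γ', Δ', h, E⟩ := (D.toInstDer hδ le_rfl).cut_elimination.realizable tc_le
  obtain ⟨hΓ, hΔ⟩ := forget_eq_filter_occs δ n Γ Δ
  exact ⟨Γ', Δ', (Below.forget_eq h.1).trans hΓ, (Below.forget_eq h.2).trans hΔ, E⟩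

end LPTN

/-- Cut is eliminable, with a hyperexponential bound on the length and without any increase of the
truth complexity; for derivations of truth complexity `0` the height of the tower is the cut rank. -/
theorem mainTheorem2 :
    ∃ C : ℕ, ∀ (n m k : ℕ) (Γ Δ : Multiset (LPTN.Fml 0)), LPTN.Provable n m k Γ Δ →
      LPTN.Provable (C * LPTN.hyperexp n n) 0 k Γ Δ ∧
      (k = 0 → LPTN.Provable (C * LPTN.hyperexp n m) 0 k Γ Δ) :=
  ⟨3, fun n m k _ _ h => ⟨(LPTN.DepthBound.length m k n).provable h, by
    rintro rfl
    exact (LPTN.DepthBound.complexity m n).provable h⟩⟩
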